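/- Let $k$ be a field, $S=k[x_1,\dots,x_n]$, and let $n,d\ge 2$. All complexes are chain complexes of free $S$-modules in homological degrees $\ge 0$. A subcomplex of a complex $G$ is a complex $F$ of free modules with a map of complexes $F\to G$ all of whose components $F_i\to G_i$ are split injective; its rank sequence is $(\operatorname{rank}F_0,\operatorname{rank}F_1,\dots)$, and $\operatorname{RS}(G)$ is the set of rank sequences of all subcomplexes of $G$. For sets of sequences, $A+B$ is the set of entrywise sums of an element of $A$ and an element of $B$, and $cA=A+\cdots+A$ ($c$ summands). For $m\le n$ let $\mathbf K_{(m)}$ be the Koszul complex on $x_1,\dots,x_m$ over $S$. Let $M^{n,d}$ be the $d\times(n+d-1)$ matrix over $S$ whose row $j$ $(1\le j\le d)$ consists of $j-1$ zeros, then $x_1,\dots,x_n$, then $d-j$ zeros. With $G=S^d$, $F=S^{n+d-1}$, let $L_{n,d}$ be the linear strand of the Eagon–Northcott complex of $M^{n,d}:F\to G$: it has $(\operatorname{Sym}_iG)^*\otimes\Lambda^{d+i}F$ in homological degree $i\ge0$, with the Eagon–Northcott differentials $$(\varepsilon^{p})^*\otimes e_{s_1}\wedge\cdots\wedge e_{s_{d+i}}\mapsto\sum_{q}(-1)^{q-1}\sum_{j:\,p_j>0}M^{n,d}_{j,s_q}\,(\varepsilon^{p}/\varepsilon_j)^*\otimes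 e_{s_1}\wedge\cdots\widehat{e_{s_q}}\cdots\wedge e_{s_{d+i}}$$ (so $L_{n,d}$ is the Eagon–Northcott resolution of the ideal $(x_1,\dots,x_n)^d$). Then $$\operatorname{RS}(L_{n,d})\subseteq\sum_{j=0}^{n-1}\binom{n-j+d-2}{d-1}\operatorname{RS}(\mathbf K_{(n-j-1)}).$$ In particular, the rank sequence of any subcomplex of $L_{n,d}$ is a linear combination with positive integer coefficients of (one or more) rank sequences of subcomplexes of Koszul complexes $\mathbf K_{(m)}$ with $m<n$. -/

import Mathlib

open scoped Pointwise

/-! Complexes of free modules, subcomplexes and rank sequences. -/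

section RankSequences

universe u

/-- `RS(G)`: the set of rank sequences `(rank F_0, rank F_1, …)` of the subcomplexes `F` of `G`.
A subcomplex of `G` is a complex `F` of free modules together with a map of complexes `F ⟶ G`
all of whose components `F_i → G_i` are split injections. -/
def RS {R : Type u} [CommRing R] (G : ChainComplex (ModuleCat.{u} R) ℕ) : Set (ℕ → ℕ) :=
  {r | ∃ (F : ChainComplex (ModuleCat.{u} R) ℕ) (φ : F ⟶ G),
      (∀ i, Module.Free R (F.X i)) ∧
      (∀ i, CategoryTheory.IsSplitMono (φ.f i)) ∧
      (∀ i, r i = Module.finrank R (F.X i))}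

/-- The `c`-fold sum `A + ⋯ + A` of a set of sequences (it is `{0}` for `c = 0`). -/
def foldSum (c : ℕ) (A : Set (ℕ → ℕ)) : Set (ℕ → ℕ) :=
  {r | ∃ s : Fin c → ℕ → ℕ, (∀ i, s i ∈ A) ∧ r = ∑ i, s i}

end RankSequences

/-! Signs. -/

/-- The sign `(-1)^(q-1)`, where `t` is the `q`-th smallest element of `T`. -/
def posSign (R : Type*) [CommRing R] {m : ℕ} (T : Finset (Fin m)) (t : Fin m) : R :=
  (-1) ^ (T.filter (· < t)).card

theorem posSign_erase {R : Type*} [CommRing R] {m : ℕ} (T : Finset (Fin m)) {a b : Fin m}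
    (ha : a ∈ T) (hb : b ∈ T) (hab : a ≠ b) :
    posSign R T a * posSign R (T.erase a) b = -(posSign R T b * posSign R (T.erase b) a) := by
  wlog h : a < b generalizing a b
  · have h' : b < a := lt_of_le_of_ne (not_lt.mp h) hab.symm
    rw [this hb ha hab.symm h', neg_neg]
  have h1 : (T.erase a).filter (· < b) = (T.filter (· < b)).erase a := by
    rw [Finset.filter_erase]
  have h2 : (T.erase b).filter (· < a) = T.filter (· < a) := by
    rw [Finset.filter_erase]
    apply Finset.erase_eq_of_notMem
    simp [h.le]
  have h3 : a ∈ T.filter (· < b) := by simp [ha, h]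
  have h4 : (T.filter (· < b)).card = ((T.filter (· < b)).erase a).card + 1 :=
    (Finset.card_erase_add_one h3).symm
  unfold posSign
  rw [h1, h2, h4, pow_succ]
  ring

/-- An antisymmetric double sum over pairs of distinct elements vanishes. -/
theorem sum_erase_eq_zero {M : Type*} [AddCommGroup M] {m : ℕ} (T : Finset (Fin m))
    (h : Fin m → Fin m → M)
    (hh : ∀ a ∈ T, ∀ b ∈ T, a ≠ b → h a b = -h b a) :
    ∑ a ∈ T, ∑ b ∈ T.erase a, h a b = 0 := by
  rw [Finset.sum_sigma']
  refine Finset.sum_involution (fun x _ => ⟨x.2, x.1⟩) ?_ ?_ ?_ ?_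
  · rintro ⟨a, b⟩ hx
    simp only [Finset.mem_sigma, Finset.mem_erase] at hx
    rw [hh a hx.1 b hx.2.2 (Ne.symm hx.2.1)]
    simp
  · rintro ⟨a, b⟩ hx _ he
    simp only [Finset.mem_sigma, Finset.mem_erase] at hx
    simp only [Sigma.mk.injEq] at he
    exact hx.2.1 he.1
  · rintro ⟨a, b⟩ hx
    simp only [Finset.mem_sigma, Finset.mem_erase] at hx ⊢
    exact ⟨hx.2.2, Ne.symm hx.2.1, hx.1⟩
  · rintro ⟨a, b⟩ _
    rfl

/-! The Koszul complex. -/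

/-- The subsets of `{1, …, m}` with `i` elements. -/
abbrev Subsets (m i : ℕ) : Type := {T : Finset (Fin m) // T.card = i}

/-- Removing an element from a set with `i + 1` elements. -/
def Subsets.erase {m i : ℕ} (T : Subsets m (i + 1)) (t : {t // t ∈ T.1}) : Subsets m i :=
  ⟨T.1.erase t.1, by rw [Finset.card_erase_of_mem t.2, T.2]; rfl⟩

section Koszul

universe u

/-- The Koszul differential `e_T ↦ ∑_q (-1)^q f_{t_q} e_{T ∖ t_q}`, `T = {t_1 < t_2 < ⋯}`, from
the free module on the `(i+1)`-element subsets to the free module on the `i`-element subsets. -/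
noncomputable def koszulD {R : Type u} [CommRing R] {m : ℕ} (f : Fin m → R) (i : ℕ) :
    (Subsets m (i + 1) →₀ R) →ₗ[R] (Subsets m i →₀ R) :=
  Finsupp.linearCombination R fun T : Subsets m (i + 1) =>
    ∑ t ∈ T.1.attach, Finsupp.single (T.erase t) (-posSign R T.1 t.1 * f t.1)

theorem koszulD_basis {R : Type u} [CommRing R] {m : ℕ} (f : Fin m → R) (i : ℕ)
    (T : Subsets m (i + 1)) :
    koszulD f i (Finsupp.single T 1) =
      ∑ t ∈ T.1.attach, Finsupp.single (T.erase t) (-posSign R T.1 t.1 * f t.1) := by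
  rw [koszulD, Finsupp.linearCombination_single, one_smul]

theorem koszulD_single {R : Type u} [CommRing R] {m : ℕ} (f : Fin m → R) (i : ℕ)
    (T : Subsets m (i + 1)) (c : R) :
    Finsupp.mapDomain Subtype.val (koszulD f i (Finsupp.single T c)) =
      ∑ t ∈ T.1, Finsupp.single (T.1.erase t) (c * (-posSign R T.1 t * f t)) := by
  rw [koszulD, Finsupp.linearCombination_single, Finset.smul_sum, Finsupp.mapDomain_finsetSum,
    ← Finset.sum_attach T.1]
  refine Finset.sum_congr rfl fun t _ => ?_
  rw [Finsupp.smul_single, Finsupp.mapDomain_single, smul_eq_mul]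
  rfl

theorem koszulD_comp {R : Type u} [CommRing R] {m : ℕ} (f : Fin m → R) (i : ℕ) :
    koszulD f i ∘ₗ koszulD f (i + 1) = 0 := by
  refine Finsupp.lhom_ext' fun T => LinearMap.ext_ring ?_
  apply Finsupp.mapDomain_injective (Subtype.val_injective (p := fun T : Finset (Fin m) => T.card = i))
  simp only [LinearMap.comp_apply, Finsupp.lsingle_apply, LinearMap.zero_apply,
    Finsupp.mapDomain_zero]
  rw [koszulD_basis, map_sum, Finsupp.mapDomain_finsetSum]
  simp only [koszulD_single]
  rw [← sum_erase_eq_zero T.1 (fun a b => Finsupp.single ((T.1.erase a).erase b)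
    (posSign R T.1 a * posSign R (T.1.erase a) b * (f a * f b))), ← Finset.sum_attach T.1]
  · refine Finset.sum_congr rfl fun a _ => Finset.sum_congr rfl fun b _ => ?_
    simp only [Subsets.erase]
    congr 1
    ring
  · intro a ha b hb hab
    rw [← Finsupp.single_neg, Finset.erase_right_comm, posSign_erase T.1 ha hb hab]
    congr 1
    ring

/-- The Koszul complex of a sequence `f_1, …, f_m` in a ring `R`. -/
noncomputable def koszulComplex {R : Type u} [CommRing R] {m : ℕ} (f : Fin m → R) :
    ChainComplex (ModuleCat.{u} R) ℕ :=
  ChainComplex.of (fun i => ModuleCat.of R (Subsets m i →₀ R))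
    (fun i => ModuleCat.ofHom (koszulD f i))
    (fun i => by rw [← ModuleCat.ofHom_comp, koszulD_comp]; rfl)

/-- `K_(m)`: the Koszul complex `K(x_1, …, x_m)` over `S = k[x_1, …, x_n]`, for `m ≤ n`. -/
noncomputable def koszulVars (k : Type u) [Field k] (n m : ℕ) (h : m ≤ n) :
    ChainComplex (ModuleCat.{u} (MvPolynomial (Fin n) k)) ℕ :=
  koszulComplex fun i : Fin m => (MvPolynomial.X (Fin.castLE h i) : MvPolynomial (Fin n) k)

end Koszul

/-! The Eagon–Northcott complex. -/

/-- The exponent vectors `(p_1, …, p_g)` with `p_1 + ⋯ + p_g = i`; they index the basis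
`(ε_1^{p_1} ⋯ ε_g^{p_g})^*` of `(Sym_i G)^*`, where `G` is free of rank `g`. -/
abbrev Exponents (g i : ℕ) : Type := {p : Fin g → ℕ // ∑ j, p j = i}

/-- Lowering a positive exponent `p_j` by one. -/
def Exponents.lower {g i : ℕ} (p : Exponents g (i + 1)) (j : Fin g) (h : 0 < p.1 j) :
    Exponents g i :=
  ⟨p.1 - Pi.single j 1, by
    have h1 : (Pi.single j 1 : Fin g → ℕ) ≤ p.1 := by
      intro l
      by_cases hl : l = j
      · subst hl; simpa using Nat.succ_le_of_lt h
      · simp [hl]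
    have h2 := p.2
    rw [← tsub_add_cancel_of_le h1] at h2
    simp only [Pi.add_apply, Finset.sum_add_distrib, Finset.sum_pi_single', Finset.mem_univ,
      if_true] at h2
    simpa using h2⟩

section EagonNorthcott

universe u

/-- The basis of the Eagon–Northcott module `EN_{i+1} = (Sym_i G)^* ⊗ Λ^{g+i} F`, where
`rank G = g` and `rank F = f`: pairs of a basis element of `(Sym_i G)^*` and
a basis element `e_{s_1} ∧ ⋯ ∧ e_{s_{g+i}}` of `Λ^{g+i} F`. -/
abbrev ENBasis (g f i : ℕ) : Type := Exponents g i × Subsets f (g + i)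

/-- The Eagon–Northcott differential `EN_{i+2} → EN_{i+1}` of a `g × f` matrix `A`:
`(ε^p)^* ⊗ e_T ↦ ∑_q (-1)^(q-1) ∑_j A_{j,t_q} (ε^p / ε_j)^* ⊗ e_{T ∖ t_q}`,
`T = {t_1 < t_2 < ⋯}`, where the terms with `p_j = 0` are omitted. -/
noncomputable def eagonNorthcottD {R : Type u} [CommRing R] {g f : ℕ}
    (A : Matrix (Fin g) (Fin f) R) (i : ℕ) :
    (ENBasis g f (i + 1) →₀ R) →ₗ[R] (ENBasis g f i →₀ R) :=
  Finsupp.linearCombination R fun b : ENBasis g f (i + 1) =>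
    ∑ t ∈ b.2.1.attach, ∑ j : Fin g,
      if h : 0 < b.1.1 j then
        Finsupp.single (b.1.lower j h, Subsets.erase (i := g + i) b.2 t)
          (posSign R b.2.1 t.1 * A j t.1)
      else 0

theorem eagonNorthcottD_basis {R : Type u} [CommRing R] {g f : ℕ}
    (A : Matrix (Fin g) (Fin f) R) (i : ℕ) (b : ENBasis g f (i + 1)) :
    eagonNorthcottD A i (Finsupp.single b 1) =
      ∑ t ∈ b.2.1.attach, ∑ j : Fin g,
        if h : 0 < b.1.1 j then
          Finsupp.single (b.1.lower j h, Subsets.erase (i := g + i) b.2 t)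
            (posSign R b.2.1 t.1 * A j t.1)
        else 0 := by
  rw [eagonNorthcottD, Finsupp.linearCombination_single, one_smul]

theorem eagonNorthcottD_single {R : Type u} [CommRing R] {g f : ℕ}
    (A : Matrix (Fin g) (Fin f) R) (i : ℕ) (b : ENBasis g f (i + 1)) (c : R) :
    Finsupp.mapDomain (Prod.map Subtype.val Subtype.val)
        (eagonNorthcottD A i (Finsupp.single b c)) =
      ∑ t ∈ b.2.1, ∑ j : Fin g, if 0 < b.1.1 j then
        Finsupp.single (b.1.1 - Pi.single j 1, b.2.1.erase t)
          (c * (posSign R b.2.1 t * A j t)) else 0 := by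
  rw [eagonNorthcottD, Finsupp.linearCombination_single, Finset.smul_sum,
    Finsupp.mapDomain_finsetSum, ← Finset.sum_attach b.2.1]
  refine Finset.sum_congr rfl fun t _ => ?_
  rw [Finset.smul_sum, Finsupp.mapDomain_finsetSum]
  refine Finset.sum_congr rfl fun j _ => ?_
  split_ifs with h
  · rw [Finsupp.smul_single, Finsupp.mapDomain_single, smul_eq_mul]
    rfl
  · simp

theorem eagonNorthcottD_comp {R : Type u} [CommRing R] {g f : ℕ}
    (A : Matrix (Fin g) (Fin f) R) (i : ℕ) :
    eagonNorthcottD A i ∘ₗ eagonNorthcottD A (i + 1) = 0 := by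
  refine Finsupp.lhom_ext' fun b => LinearMap.ext_ring ?_
  have hinj : Function.Injective (Prod.map Subtype.val Subtype.val :
      ENBasis g f i → (Fin g → ℕ) × Finset (Fin f)) :=
    Subtype.val_injective.prodMap Subtype.val_injective
  apply Finsupp.mapDomain_injective hinj
  simp only [LinearMap.comp_apply, Finsupp.lsingle_apply, LinearMap.zero_apply,
    Finsupp.mapDomain_zero]
  rw [eagonNorthcottD_basis, map_sum, Finsupp.mapDomain_finsetSum]
  rw [← sum_erase_eq_zero b.2.1 (fun a a' => ∑ j : Fin g, ∑ j' : Fin g,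
    if 0 < b.1.1 j ∧ 0 < (b.1.1 - Pi.single j 1 : Fin g → ℕ) j' then
      Finsupp.single (b.1.1 - Pi.single j 1 - Pi.single j' 1, (b.2.1.erase a).erase a')
        (posSign R b.2.1 a * posSign R (b.2.1.erase a) a' * (A j a * A j' a'))
    else 0), ← Finset.sum_attach b.2.1]
  · refine Finset.sum_congr rfl fun a _ => ?_
    rw [map_sum, Finsupp.mapDomain_finsetSum, Finset.sum_comm]
    refine Finset.sum_congr rfl fun j _ => ?_
    by_cases h : 0 < b.1.1 j
    · rw [dif_pos h, eagonNorthcottD_single]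
      simp only [Subsets.erase, Exponents.lower, h, true_and]
      refine Finset.sum_congr rfl fun a' _ => Finset.sum_congr rfl fun j' _ => ?_
      by_cases h' : 0 < (b.1.1 - Pi.single j 1 : Fin g → ℕ) j'
      · rw [if_pos h']
        refine (if_pos h').trans ?_
        congr 1
        ring
      · rw [if_neg h']
        exact if_neg h'
    · simp [h]
  · intro a ha a' ha' haa'
    rw [Finset.sum_comm, ← Finset.sum_neg_distrib]
    refine Finset.sum_congr rfl fun j' _ => ?_
    rw [← Finset.sum_neg_distrib]
    refine Finset.sum_congr rfl fun j _ => ?_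
    have hc : (0 < b.1.1 j ∧ 0 < (b.1.1 - Pi.single j 1 : Fin g → ℕ) j') ↔
        (0 < b.1.1 j' ∧ 0 < (b.1.1 - Pi.single j' 1 : Fin g → ℕ) j) := by
      by_cases hj : j = j'
      · subst hj; rfl
      · simp [hj, Ne.symm hj, and_comm]
    simp only [hc]
    split_ifs
    · rw [← Finsupp.single_neg, Finset.erase_right_comm, tsub_right_comm,
        posSign_erase b.2.1 ha ha' haa']
      congr 1
      ring
    · simp

/-- The part `⋯ → EN_3 → EN_2 → EN_1` of the Eagon–Northcott complex of a `g × f` matrix,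
i.e. without its last map `EN_1 → Λ^g G`, re-indexed so that `EN_{i+1}` sits in
homological degree `i`. -/
noncomputable def eagonNorthcottStrand {R : Type u} [CommRing R] {g f : ℕ}
    (A : Matrix (Fin g) (Fin f) R) : ChainComplex (ModuleCat.{u} R) ℕ :=
  ChainComplex.of (fun i => ModuleCat.of R (ENBasis g f i →₀ R))
    (fun i => ModuleCat.ofHom (eagonNorthcottD A i))
    (fun i => by rw [← ModuleCat.ofHom_comp, eagonNorthcottD_comp]; rfl)

/-- The `d × (n+d-1)` matrix `M^{n,d}`, whose row `j` (counted from `0`) consists of `j` zeros,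
the variables `x_1, …, x_n`, and `d - 1 - j` zeros. -/
noncomputable def enMatrix (k : Type u) [Field k] (n d : ℕ) :
    Matrix (Fin d) (Fin (n + d - 1)) (MvPolynomial (Fin n) k) :=
  Matrix.of fun j s =>
    if h : j.1 ≤ s.1 ∧ s.1 - j.1 < n then MvPolynomial.X ⟨s.1 - j.1, h.2⟩ else 0

/-- `L_{n,d}`: the resolution of the ideal `(x_1, …, x_n)^d` of `S = k[x_1, …, x_n]` given by the
Eagon–Northcott complex of `M^{n,d}`. -/
noncomputable def linearStrand (k : Type u) [Field k] (n d : ℕ) :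
    ChainComplex (ModuleCat.{u} (MvPolynomial (Fin n) k)) ℕ :=
  eagonNorthcottStrand (enMatrix k n d)

end EagonNorthcott

/-! The differentials of `linearStrand` and of the Koszul complexes have entries that are linear
forms, `∑ x_l D_l` with `D_l` matrices over `k`. For such a complex, rank sequences are a matter of
linear algebra over `k`. The constant parts of a split subcomplex form subspaces `V i` of dimension
`rank F_i`, with `D_l` mapping `V (i + 1)` into `V i` (`exists_stable_of_mem_RS`). Conversely,
subspaces stable in this way span a subcomplex (`finrank_mem_RS`). In both complexes the `D_l`
anticommute and have square zero, so the `V i` form a graded module over an exterior algebra in `n`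
generators.

An element `z` of degree `i` of the strand is turned into an alternating form with polynomial
values: apply to `z` the operators indexed by an `i`-subset `I` of the variables, then send the
resulting element of degree 0 to `S_d` by the maximal minors of `M^{n,d}`. This encoding is
injective, because no nonzero element of positive degree is killed by all operators
(`IsStrandForm.eq_zero_of_enContract`) and because the minors are linearly independent
(`eq_zero_of_sum_smul_stripMinor_eq_zero`). It turns the operators into contractions
(`cycleCoeff_enContract`). Its values are Koszul cycles, by Laplace expansion
(`sum_X_mul_minorForm_enContract`).

Now filter by the monomials `u` of degree `d`. Let `W u i` be the space of coefficients of `u` in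
the forms from `V i` all of whose lexicographically smaller coefficients vanish. The dimensions of
the `W u i` add up to that of `V i` (`finrank_eq_sum_leadingPart`), and each `W u` is stable under
contraction. Comparing coefficients of `u * x_l` in the cycle relation shows that `W u` involves
only variables strictly before the last variable of `u` (`cycleCoeff_eq_zero_of_mem`). So if that
variable is `x_{m+1}`, then `W u` gives a rank sequence in `RS(K_(m))`. The binomial coefficient
counts these monomials. -/

/-! ### Subcomplexes of linear complexes and stable subspaces over `k`. -/

section RankTransfer

open CategoryTheory

universe u

variable {k : Type u} [Field k] {n : ℕ}

/-- The coefficient of a monomial, taken entrywise in a free module over a polynomial ring. -/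
noncomputable def coeffPart {B : Type*} (e : Fin n →₀ ℕ) :
    (B →₀ MvPolynomial (Fin n) k) →ₗ[k] (B →₀ k) :=
  Finsupp.mapRange.linearMap (MvPolynomial.lcoeff k e)

/-- Vectors over `k` as vectors of constant polynomials. -/
noncomputable def constExt {B : Type*} :
    (B →₀ k) →ₗ[k] (B →₀ MvPolynomial (Fin n) k) :=
  Finsupp.mapRange.linearMap (Algebra.linearMap k (MvPolynomial (Fin n) k))

@[simp] theorem coeffPart_apply {B : Type*} (e : Fin n →₀ ℕ)
    (z : B →₀ MvPolynomial (Fin n) k) (b : B) :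
    coeffPart e z b = MvPolynomial.coeff e (z b) := rfl

@[simp] theorem constExt_apply {B : Type*} (w : B →₀ k) (b : B) :
    (constExt w : B →₀ MvPolynomial (Fin n) k) b = MvPolynomial.C (w b) := rfl

theorem constExt_single {B : Type*} (b : B) (c : k) :
    (constExt (Finsupp.single b c) : B →₀ MvPolynomial (Fin n) k) =
      Finsupp.single b (MvPolynomial.C c) := by
  simp [constExt, MvPolynomial.algebraMap_eq]

theorem coeffPart_zero_smul {B : Type*} (s : MvPolynomial (Fin n) k)
    (z : B →₀ MvPolynomial (Fin n) k) :
    coeffPart 0 (s • z) = MvPolynomial.coeff 0 s • coeffPart 0 z := by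
  ext b
  simp [← MvPolynomial.constantCoeff_eq]

theorem coeff_single_mul (l : Fin n) (s t : MvPolynomial (Fin n) k) :
    MvPolynomial.coeff (Finsupp.single l 1) (s * t) =
      MvPolynomial.coeff (Finsupp.single l 1) s * MvPolynomial.coeff 0 t +
      MvPolynomial.coeff 0 s * MvPolynomial.coeff (Finsupp.single l 1) t := by
  rw [MvPolynomial.coeff_mul, Finsupp.antidiagonal_single]
  simp [Finset.Nat.antidiagonal_succ, add_comm]

theorem coeffPart_single_smul {B : Type*} (l : Fin n) (s : MvPolynomial (Fin n) k)
    (z : B →₀ MvPolynomial (Fin n) k) :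
    coeffPart (Finsupp.single l 1) (s • z) =
      MvPolynomial.coeff (Finsupp.single l 1) s • coeffPart 0 z +
      MvPolynomial.coeff 0 s • coeffPart (Finsupp.single l 1) z := by
  ext b
  simp [coeff_single_mul]

/-- A linear map between free modules over `k[x_1, …, x_n]` is given by linear forms, with
coefficient maps `D_l`, if it agrees with `∑ x_l D_l` on constant vectors. -/
def IsLinearMapOfForms {B' B : Type*}
    (d : (B' →₀ MvPolynomial (Fin n) k) →ₗ[MvPolynomial (Fin n) k]
      (B →₀ MvPolynomial (Fin n) k))
    (D : Fin n → (B' →₀ k) →ₗ[k] (B →₀ k)) : Prop :=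
  ∀ w, d (constExt w) = ∑ l, (MvPolynomial.X l : MvPolynomial (Fin n) k) • constExt (D l w)

theorem eq_sum_smul_constExt {B : Type*} (z : B →₀ MvPolynomial (Fin n) k) :
    z = z.sum fun b s => s • constExt (Finsupp.single b (1 : k)) := by
  conv_lhs => rw [← Finsupp.sum_single z]
  refine Finsupp.sum_congr fun b _ => ?_
  simp [constExt_single]

namespace IsLinearMapOfForms

variable {B' B : Type*}
  {d : (B' →₀ MvPolynomial (Fin n) k) →ₗ[MvPolynomial (Fin n) k]
      (B →₀ MvPolynomial (Fin n) k)}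
  {D : Fin n → (B' →₀ k) →ₗ[k] (B →₀ k)}

theorem coeff_zero (h : IsLinearMapOfForms d D) (z : B' →₀ MvPolynomial (Fin n) k) :
    coeffPart 0 (d z) = 0 := by
  rw [eq_sum_smul_constExt z, Finsupp.sum, map_sum, map_sum]
  refine Finset.sum_eq_zero fun b _ => ?_
  rw [map_smul, h, coeffPart_zero_smul, map_sum]
  simp [coeffPart_zero_smul]

/-- Only the constant part of `z` can contribute to the degree-one part of `d z`. The vector `z`
need not be homogeneous, so subcomplexes need no grading. -/
theorem coeff_single (h : IsLinearMapOfForms d D) (l : Fin n)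
    (z : B' →₀ MvPolynomial (Fin n) k) :
    coeffPart (Finsupp.single l 1) (d z) = D l (coeffPart 0 z) := by
  rw [eq_sum_smul_constExt z, Finsupp.sum, map_sum, map_sum, map_sum, map_sum]
  refine Finset.sum_congr rfl fun b _ => ?_
  have h0 : ∀ w : B →₀ k, coeffPart 0 (constExt w : B →₀ MvPolynomial (Fin n) k) = w := by
    intro w; ext b; simp
  have h0' : ∀ w : B' →₀ k, coeffPart 0 (constExt w : B' →₀ MvPolynomial (Fin n) k) = w := by
    intro w; ext b; simp
  rw [map_smul, coeffPart_single_smul, h.coeff_zero, smul_zero, zero_add, h,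
    coeffPart_zero_smul, map_smul, h0', map_sum]
  congr 1
  rw [Finset.sum_eq_single l]
  · rw [coeffPart_single_smul, h0]
    simp
  · intro m _ hm
    rw [coeffPart_single_smul, h0]
    simp [MvPolynomial.coeff_X, Finsupp.single_left_inj, hm]
  · simp

end IsLinearMapOfForms

/-- The constant parts of a split free submodule of a free module. -/
theorem exists_constant_part {B : Type*} [Finite B] {N : Type*} [AddCommGroup N]
    [Module (MvPolynomial (Fin n) k) N] [Module.Free (MvPolynomial (Fin n) k) N]
    (φ : N →ₗ[MvPolynomial (Fin n) k] (B →₀ MvPolynomial (Fin n) k))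
    (ρ : (B →₀ MvPolynomial (Fin n) k) →ₗ[MvPolynomial (Fin n) k] N)
    (h : ∀ x, ρ (φ x) = x) :
    ∃ V : Submodule k (B →₀ k),
      Module.finrank k V = Module.finrank (MvPolynomial (Fin n) k) N ∧
      (∀ x, coeffPart 0 (φ x) ∈ V) ∧
      (∀ v ∈ V, ∃ x, coeffPart 0 (φ x) = v) ∧
      ∀ x, coeffPart 0 (φ x) = 0 → ∀ l, coeffPart (Finsupp.single l 1) (φ x) ∈ V := by
  have : Module.Finite (MvPolynomial (Fin n) k) N :=
    Module.Finite.of_surjective ρ fun x => ⟨φ x, h x⟩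
  set b := Module.Free.chooseBasis (MvPolynomial (Fin n) k) N
  have key : ∀ x, coeffPart 0 (φ x) = ∑ a, MvPolynomial.coeff 0 (b.repr x a) •
      coeffPart 0 (φ (b a)) := by
    intro x
    conv_lhs => rw [← b.sum_repr x]
    simp only [map_sum, map_smul, coeffPart_zero_smul]
  -- This is where splitness enters: since `ρ ∘ φ = id`, the coordinates of `x` are combinations of
  -- the entries of `φ x`, so their constant terms vanish with those of `φ x`.
  have hker : ∀ x, coeffPart 0 (φ x) = 0 → ∀ a, MvPolynomial.coeff 0 (b.repr x a) = 0 := by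
    intro x hx a
    have h1 : b.repr x a = (φ x).sum fun β s => s * b.repr (ρ (Finsupp.single β 1)) a := by
      conv_lhs => rw [← h x, ← Finsupp.sum_single (φ x)]
      rw [Finsupp.sum, map_sum, map_sum, Finsupp.finsetSum_apply]
      refine Finset.sum_congr rfl fun β _ => ?_
      have : Finsupp.single β (φ x β) = φ x β • Finsupp.single β 1 := by simp
      rw [this, map_smul, map_smul]
      simp
    rw [h1, Finsupp.sum, MvPolynomial.coeff_sum]
    refine Finset.sum_eq_zero fun β _ => ?_
    have h2 : MvPolynomial.coeff 0 (φ x β) = 0 := by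
      simpa using DFunLike.congr_fun hx β
    rw [← MvPolynomial.constantCoeff_eq, map_mul, MvPolynomial.constantCoeff_eq, h2, zero_mul]
  have hli : LinearIndependent k fun a => coeffPart 0 (φ (b a)) := by
    rw [Fintype.linearIndependent_iff]
    intro g hg a
    have h1 := hker (∑ a, (MvPolynomial.C (g a) : MvPolynomial (Fin n) k) • b a) ?_ a
    · rw [b.repr_sum_self] at h1
      simpa using h1
    · rw [key]
      simp only [b.repr_sum_self]
      simpa using hg
  refine ⟨Submodule.span k (Set.range fun a => coeffPart 0 (φ (b a))), ?_, ?_, ?_, ?_⟩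
  · rw [finrank_span_eq_card hli, Module.finrank_eq_card_basis b]
  · intro x
    rw [key]
    exact Submodule.sum_mem _ fun a _ =>
      Submodule.smul_mem _ _ (Submodule.subset_span ⟨a, rfl⟩)
  · intro v hv
    obtain ⟨c, rfl⟩ := (Submodule.mem_span_range_iff_exists_fun k).1 hv
    refine ⟨∑ a, (MvPolynomial.C (c a) : MvPolynomial (Fin n) k) • b a, ?_⟩
    rw [key]
    simp only [b.repr_sum_self]
    simp
  -- The coordinates of `x` have no constant term, so the linear part of `φ x` sees only the
  -- constant parts of the `φ (b a)`.
  · intro x hx l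
    have h1 : φ x = ∑ a, b.repr x a • φ (b a) := by
      conv_lhs => rw [← b.sum_repr x]
      simp only [map_sum, map_smul]
    rw [h1, map_sum]
    refine Submodule.sum_mem _ fun a _ => ?_
    rw [coeffPart_single_smul, hker x hx a, zero_smul, add_zero]
    exact Submodule.smul_mem _ _ (Submodule.subset_span ⟨a, rfl⟩)


theorem chainComplex_of_d_succ {C : Type*} [Category C] [Limits.HasZeroMorphisms C] (X : ℕ → C)
    (d : ∀ i, X (i + 1) ⟶ X i) (sq : ∀ i, d (i + 1) ≫ d i = 0) (i : ℕ) :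
    (ChainComplex.of X d sq).d (i + 1) i = d i :=
  ChainComplex.of_d X d i

/-- The constant parts of a subcomplex of a complex given by linear forms are stable under the
coefficient maps of the differentials. -/
theorem exists_stable_of_mem_RS {B : ℕ → Type} [∀ i, Finite (B i)]
    (d : ∀ i, (B (i + 1) →₀ MvPolynomial (Fin n) k) →ₗ[MvPolynomial (Fin n) k]
      (B i →₀ MvPolynomial (Fin n) k))
    (D : ∀ i, Fin n → (B (i + 1) →₀ k) →ₗ[k] (B i →₀ k))
    (hD : ∀ i, IsLinearMapOfForms (d i) (D i))
    (sq : ∀ i, ModuleCat.ofHom (d (i + 1)) ≫ ModuleCat.ofHom (d i) = 0) {r : ℕ → ℕ}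
    (hr : r ∈ RS (ChainComplex.of
      (fun i => ModuleCat.of (MvPolynomial (Fin n) k) (B i →₀ MvPolynomial (Fin n) k))
      (fun i => ModuleCat.ofHom (d i)) sq)) :
    ∃ V : ∀ i, Submodule k (B i →₀ k), (∀ i, Module.finrank k (V i) = r i) ∧
      ∀ i, ∀ v ∈ V (i + 1), ∀ l, D i l v ∈ V i := by
  obtain ⟨F, φ, hfree, hsplit, hrank⟩ := hr
  have hex : ∀ i, ∃ V : Submodule k (B i →₀ k),
      Module.finrank k V = Module.finrank (MvPolynomial (Fin n) k) (F.X i) ∧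
      (∀ x : F.X i, coeffPart 0 ((φ.f i).hom x : B i →₀ MvPolynomial (Fin n) k) ∈ V) ∧
      (∀ v ∈ V, ∃ x : F.X i, coeffPart 0 ((φ.f i).hom x : B i →₀ MvPolynomial (Fin n) k) = v) ∧
      ∀ x : F.X i, coeffPart 0 ((φ.f i).hom x : B i →₀ MvPolynomial (Fin n) k) = 0 →
        ∀ l, coeffPart (Finsupp.single l 1)
          ((φ.f i).hom x : B i →₀ MvPolynomial (Fin n) k) ∈ V := by
    intro i
    have := hfree i
    obtain ⟨⟨ρ⟩⟩ := hsplit i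
    refine exists_constant_part (φ.f i).hom ρ.retraction.hom fun x => ?_
    exact congrArg (fun f => f.hom x) ρ.id
  choose V hV1 hV2 hV3 hV4 using hex
  refine ⟨V, fun i => (hV1 i).trans (hrank i).symm, fun i v hv l => ?_⟩
  obtain ⟨x, rfl⟩ := hV3 (i + 1) v hv
  have hcomm : (φ.f i).hom ((F.d (i + 1) i).hom x) = d i ((φ.f (i + 1)).hom x) := by
    have h1 := congrArg (fun f => f.hom x) (φ.comm (i + 1) i)
    rw [chainComplex_of_d_succ] at h1
    exact h1.symm
  rw [← (hD i).coeff_single, ← hcomm]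
  refine hV4 i _ ?_ l
  rw [hcomm, (hD i).coeff_zero]

/-- The extension of a `k`-linear map to polynomial coefficients. -/
noncomputable def polyExt {A B : Type*} (f : (A →₀ k) →ₗ[k] (B →₀ k)) :
    (A →₀ MvPolynomial (Fin n) k) →ₗ[MvPolynomial (Fin n) k] (B →₀ MvPolynomial (Fin n) k) :=
  Finsupp.linearCombination _ fun a => constExt (f (Finsupp.single a 1))

theorem constExt_smul {B : Type*} (c : k) (w : B →₀ k) :
    (constExt (c • w) : B →₀ MvPolynomial (Fin n) k) =
      (MvPolynomial.C c : MvPolynomial (Fin n) k) • constExt w := by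
  ext b
  simp

theorem polyExt_constExt {A B : Type*} (f : (A →₀ k) →ₗ[k] (B →₀ k)) (w : A →₀ k) :
    polyExt f (constExt w : A →₀ MvPolynomial (Fin n) k) = constExt (f w) := by
  induction w using Finsupp.induction_linear with
  | zero => simp
  | add v w hv hw => simp only [map_add, hv, hw]
  | single a c =>
    have h : Finsupp.single a c = c • Finsupp.single a (1 : k) := by simp
    rw [constExt_single, polyExt, Finsupp.linearCombination_single, h, map_smul, constExt_smul]

theorem polyExt_single_one {A B : Type*} (f : (A →₀ k) →ₗ[k] (B →₀ k)) (a : A) :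
    polyExt f (Finsupp.single a (1 : MvPolynomial (Fin n) k)) =
      constExt (f (Finsupp.single a 1)) := by
  rw [polyExt, Finsupp.linearCombination_single, one_smul]

/-- Coordinates on a subspace that extend to the whole space. -/
theorem Submodule.exists_coordinates {K V : Type*} [Field K] [AddCommGroup V] [Module K V]
    [FiniteDimensional K V] (W : Submodule K V) :
    ∃ (A : (Fin (Module.finrank K W) →₀ K) →ₗ[K] V) (R : V →ₗ[K] (Fin (Module.finrank K W) →₀ K)),
      (∀ x, R (A x) = x) ∧ (∀ x, A x ∈ W) ∧ ∀ w ∈ W, A (R w) = w := by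
  let e := (Module.finBasis K W).repr
  obtain ⟨R, hR⟩ := LinearMap.exists_leftInverse_of_injective W.subtype W.ker_subtype
  have hR' : ∀ x : W, R x = x := fun x => LinearMap.congr_fun hR x
  refine ⟨W.subtype ∘ₗ e.symm.toLinearMap, e.toLinearMap ∘ₗ R, fun x => ?_, fun x => ?_,
    fun w hw => ?_⟩
  · simp [hR']
  · simp
  · have := hR' ⟨w, hw⟩
    simp only at this
    simp [this]

/-- Subspaces stable under the coefficient maps span a subcomplex. -/
theorem finrank_mem_RS {B : ℕ → Type} [∀ i, Finite (B i)]
    (d : ∀ i, (B (i + 1) →₀ MvPolynomial (Fin n) k) →ₗ[MvPolynomial (Fin n) k]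
      (B i →₀ MvPolynomial (Fin n) k))
    (D : ∀ i, Fin n → (B (i + 1) →₀ k) →ₗ[k] (B i →₀ k))
    (hD : ∀ i, IsLinearMapOfForms (d i) (D i))
    (sq : ∀ i, ModuleCat.ofHom (d (i + 1)) ≫ ModuleCat.ofHom (d i) = 0)
    (W : ∀ i, Submodule k (B i →₀ k)) (hW : ∀ i, ∀ w ∈ W (i + 1), ∀ l, D i l w ∈ W i) :
    (fun i => Module.finrank k (W i)) ∈ RS (ChainComplex.of
      (fun i => ModuleCat.of (MvPolynomial (Fin n) k) (B i →₀ MvPolynomial (Fin n) k))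
      (fun i => ModuleCat.ofHom (d i)) sq) := by
  have hex : ∀ i, ∃ (A : (Fin (Module.finrank k (W i)) →₀ k) →ₗ[k] (B i →₀ k))
      (R : (B i →₀ k) →ₗ[k] (Fin (Module.finrank k (W i)) →₀ k)),
      (∀ x, R (A x) = x) ∧ (∀ x, A x ∈ W i) ∧ ∀ w ∈ W i, A (R w) = w := by
    intro i
    exact (W i).exists_coordinates
  choose A R hRA hAW hAR using hex
  have hRA' : ∀ i x, polyExt (R i) (polyExt (A i) x) = (x : _ →₀ MvPolynomial (Fin n) k) := by
    intro i x
    refine LinearMap.congr_fun (f := polyExt (R i) ∘ₗ polyExt (A i)) (g := LinearMap.id)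
      (Finsupp.lhom_ext' fun a => LinearMap.ext_ring ?_) x
    simp [polyExt_single_one, polyExt_constExt, hRA, constExt_single]
  let δ : ∀ i, (Fin (Module.finrank k (W (i + 1))) →₀ MvPolynomial (Fin n) k)
      →ₗ[MvPolynomial (Fin n) k] (Fin (Module.finrank k (W i)) →₀ MvPolynomial (Fin n) k) :=
    fun i => polyExt (R i) ∘ₗ d i ∘ₗ polyExt (A (i + 1))
  have hδ : ∀ i x, polyExt (A i) (δ i x) = d i (polyExt (A (i + 1)) x) := by
    intro i x
    refine LinearMap.congr_fun (f := polyExt (A i) ∘ₗ δ i) (g := d i ∘ₗ polyExt (A (i + 1)))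
      (Finsupp.lhom_ext' fun a => LinearMap.ext_ring ?_) x
    simp only [δ, LinearMap.comp_apply, Finsupp.lsingle_apply, polyExt_single_one]
    rw [hD i, map_sum, map_sum]
    refine Finset.sum_congr rfl fun l _ => ?_
    -- By stability `D i l` lands in `W i`, where `A i ∘ R i` is the identity.
    rw [map_smul, map_smul, polyExt_constExt, polyExt_constExt,
      hAR i _ (hW i _ (hAW (i + 1) _) l)]
  have hdd : ∀ i x, d i (d (i + 1) x) = 0 := fun i x =>
    congrArg (fun f => f.hom x) (sq i)
  have hδδ : ∀ i, ModuleCat.ofHom (δ (i + 1)) ≫ ModuleCat.ofHom (δ i) = 0 := by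
    intro i
    ext1
    refine LinearMap.ext fun x => ?_
    have h1 : δ i (δ (i + 1) x) = 0 := by
      rw [← hRA' i (δ i (δ (i + 1) x)), hδ, hδ, hdd, map_zero]
    exact h1
  refine ⟨ChainComplex.of
      (fun i => ModuleCat.of (MvPolynomial (Fin n) k)
        (Fin (Module.finrank k (W i)) →₀ MvPolynomial (Fin n) k))
      (fun i => ModuleCat.ofHom (δ i)) hδδ,
    ChainComplex.ofHom (fun i => ModuleCat.ofHom (polyExt (A i))) (fun i => ?_), fun i => ?_,
    fun i => ?_, fun i => ?_⟩
  · rw [chainComplex_of_d_succ, chainComplex_of_d_succ]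
    ext1
    exact LinearMap.ext fun x => (hδ i x).symm
  · exact inferInstanceAs (Module.Free (MvPolynomial (Fin n) k)
      (Fin (Module.finrank k (W i)) →₀ MvPolynomial (Fin n) k))
  · refine ⟨⟨⟨ModuleCat.ofHom (polyExt (R i)), ?_⟩⟩⟩
    ext1
    exact LinearMap.ext fun x => hRA' i x
  · exact ((Module.finrank_finsupp_self (MvPolynomial (Fin n) k)).trans (Fintype.card_fin _)).symm

end RankTransfer

/-! ### Contraction operators and their exterior algebra relations. -/

section Contractions

variable {k : Type*} [CommRing k]

/-- The contraction of an alternating form, given by its coefficients on the finite sets of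
indices, with the `s`-th coordinate. -/
def contract (s : ℕ) : (Finset ℕ → k) →ₗ[k] (Finset ℕ → k) where
  toFun w T := if s ∈ T then 0 else (-1) ^ (T.filter (· < s)).card * w (insert s T)
  map_add' v w := by
    ext T
    by_cases h : s ∈ T <;> simp [h, mul_add]
  map_smul' c w := by
    ext T
    by_cases h : s ∈ T <;> simp [h, mul_left_comm]

theorem contract_apply (s : ℕ) (w : Finset ℕ → k) (T : Finset ℕ) :
    contract s w T = if s ∈ T then 0 else (-1) ^ (T.filter (· < s)).card * w (insert s T) := rfl

theorem contract_apply_of_mem {s : ℕ} {T : Finset ℕ} (h : s ∈ T) (w : Finset ℕ → k) :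
    contract s w T = 0 := if_pos h

theorem contract_apply_of_notMem {s : ℕ} {T : Finset ℕ} (h : s ∉ T) (w : Finset ℕ → k) :
    contract s w T = (-1) ^ (T.filter (· < s)).card * w (insert s T) := if_neg h

theorem contract_contract_self (s : ℕ) (w : Finset ℕ → k) : contract s (contract s w) = 0 := by
  ext T
  by_cases h : s ∈ T
  · exact contract_apply_of_mem h _
  · rw [contract_apply_of_notMem h, contract_apply_of_mem (Finset.mem_insert_self s T)]
    simp

theorem contract_contract (s t : ℕ) (w : Finset ℕ → k) :
    contract s (contract t w) = -contract t (contract s w) := by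
  wlog hst : s < t generalizing s t
  · rcases eq_or_lt_of_le (not_lt.1 hst) with h | h
    · subst h; simp [contract_contract_self]
    · rw [this t s h, neg_neg]
  ext T
  simp only [contract_apply, Pi.neg_apply, Finset.mem_insert, hst.ne, hst.ne', false_or,
    Finset.insert_comm t s]
  by_cases hs : s ∈ T
  · simp [hs]
  by_cases ht : t ∈ T
  · simp [ht]
  have h1 : (insert s T).filter (· < t) = insert s (T.filter (· < t)) := by
    rw [Finset.filter_insert, if_pos hst]
  have h2 : (insert t T).filter (· < s) = T.filter (· < s) := by
    rw [Finset.filter_insert, if_neg (by omega)]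
  rw [if_neg hs, if_neg ht, if_neg ht, if_neg hs, h1, h2, Finset.card_insert_of_notMem (by simp [hs])]
  ring

/-- The coefficient maps of the Eagon–Northcott differential of `M^{n,d}`: the contraction by
`∑_j ε_j ⊗ f_{l+j}` on `(Sym G)^* ⊗ Λ F`. -/
def enContract {d : ℕ} (l : ℕ) :
    ((Fin d → ℕ) → Finset ℕ → k) →ₗ[k] ((Fin d → ℕ) → Finset ℕ → k) where
  toFun z p := ∑ j : Fin d, contract (l + j) (z (p + Pi.single j 1))
  map_add' v w := by
    ext1 p
    simp [Finset.sum_add_distrib]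
  map_smul' c w := by
    ext1 p
    simp [Finset.smul_sum]

theorem enContract_apply {d : ℕ} (l : ℕ) (z : (Fin d → ℕ) → Finset ℕ → k) (p : Fin d → ℕ) :
    enContract l z p = ∑ j : Fin d, contract (l + j) (z (p + Pi.single j 1)) := rfl

/-- Swapping the two summation indices of `∑_{i,j}` preserves the shift of exponents and
interchanges two anticommuting contractions. -/
theorem enContract_enContract {d : ℕ} (l m : ℕ) (z : (Fin d → ℕ) → Finset ℕ → k) :
    enContract l (enContract m z) = -enContract m (enContract l z) := by
  ext1 p
  simp only [enContract_apply, map_sum, Pi.neg_apply]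
  rw [Finset.sum_comm, ← Finset.sum_neg_distrib]
  refine Finset.sum_congr rfl fun j _ => ?_
  rw [← Finset.sum_neg_distrib]
  refine Finset.sum_congr rfl fun i _ => ?_
  rw [contract_contract, add_right_comm]

theorem enContract_enContract_self {d : ℕ} (l : ℕ) (z : (Fin d → ℕ) → Finset ℕ → k) :
    enContract l (enContract l z) = 0 := by
  ext1 p
  simp only [enContract_apply, map_sum, Pi.zero_apply]
  rw [← sum_erase_eq_zero (Finset.univ : Finset (Fin d)) (fun i j => contract (l + i)
    (contract (l + j) (z (p + Pi.single i 1 + Pi.single j 1))))]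
  · refine Finset.sum_congr rfl fun i _ => ?_
    rw [Finset.sum_erase]
    exact contract_contract_self _ _
  · intro i _ j _ _
    rw [contract_contract, add_right_comm]

end Contractions

/-! ### Ordered monomials in anticommuting operators of square zero. -/

section SortedProducts

variable {A : Type*} [Ring A]

/-- The product of the `D_i` with `i < r` and `i ∈ I`, in decreasing order of the indices. -/
def descProd (D : ℕ → A) : ℕ → Finset ℕ → A
  | 0, _ => 1
  | r + 1, I => if r ∈ I then D r * descProd D r I else descProd D r I

theorem descProd_congr (D : ℕ → A) {r : ℕ} {I J : Finset ℕ} (h : ∀ i < r, i ∈ I ↔ i ∈ J) :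
    descProd D r I = descProd D r J := by
  induction r with
  | zero => rfl
  | succ r ih => simp only [descProd, h r (Nat.lt_succ_self r), ih fun i hi => h i (by omega)]

theorem card_filter_lt_succ (I : Finset ℕ) (r : ℕ) :
    (I.filter (· < r + 1)).card = (I.filter (· < r)).card + if r ∈ I then 1 else 0 := by
  split_ifs with h
  · rw [← Finset.card_insert_of_notMem (a := r) (by simp)]
    congr 1
    ext i
    simp only [Finset.mem_filter, Finset.mem_insert]
    constructor
    · rintro ⟨h1, h2⟩
      rcases Nat.lt_succ_iff_lt_or_eq.1 h2 with h3 | h3 <;> simp [h1, h3]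
    · rintro (rfl | ⟨h1, h2⟩)
      · exact ⟨h, by omega⟩
      · exact ⟨h1, by omega⟩
  · rw [add_zero]
    congr 1
    ext i
    simp only [Finset.mem_filter, and_congr_right_iff]
    intro hi
    have : i ≠ r := by rintro rfl; exact h hi
    omega

theorem descProd_mul_comm {D : ℕ → A} (hD : ∀ l m, D l * D m = -(D m * D l)) (r l : ℕ)
    (I : Finset ℕ) :
    descProd D r I * D l = (-1) ^ (I.filter (· < r)).card * (D l * descProd D r I) := by
  induction r with
  | zero => simp [descProd]
  | succ r ih =>
    rw [card_filter_lt_succ]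
    by_cases h : r ∈ I
    · simp only [descProd, if_pos h, pow_succ]
      rw [mul_assoc, ih, ← mul_assoc (D l), hD l r, ← mul_assoc, ← mul_assoc,
        ← ((Commute.neg_one_left (D r)).pow_left _).eq]
      simp only [mul_assoc, neg_mul, mul_neg, one_mul, neg_neg]
    · simp only [descProd, if_neg h, add_zero, ih]

/-- With decreasing indices, a factor `D l` entering from the right passes exactly the factors of
index below `l`. The resulting sign is the one in `contract`. -/
theorem descProd_mul {D : ℕ → A} (hD : ∀ l m, D l * D m = -(D m * D l))
    (hD0 : ∀ l, D l * D l = 0) {r l : ℕ} (hl : l < r) (I : Finset ℕ) :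
    descProd D r I * D l = if l ∈ I then 0 else
      (-1) ^ (I.filter (· < l)).card * descProd D r (insert l I) := by
  induction r with
  | zero => omega
  | succ r ih =>
    rcases Nat.lt_succ_iff_lt_or_eq.1 hl with h | rfl
    · have h1 : r ∈ insert l I ↔ r ∈ I := by simp [h.ne']
      by_cases hr : r ∈ I
      · simp only [descProd, h1, if_pos hr]
        rw [mul_assoc, ih h]
        split_ifs
        · simp
        · rw [← mul_assoc, ← mul_assoc, ((Commute.neg_one_left (D r)).pow_left _).eq]
      · simp only [descProd, h1, if_neg hr]
        exact ih h
    · by_cases hr : l ∈ I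
      · simp only [descProd, if_pos hr]
        rw [mul_assoc, descProd_mul_comm hD, ← mul_assoc,
          ← ((Commute.neg_one_left (D l)).pow_left _).eq, mul_assoc, ← mul_assoc (D l), hD0]
        simp
      · simp only [descProd, if_neg hr, if_pos (Finset.mem_insert_self l I)]
        rw [descProd_mul_comm hD]
        congr 2
        refine descProd_congr D fun i hi => ?_
        simp [hi.ne]

end SortedProducts

/-! ### No socle in positive degree of the strand. -/

section Socle

variable {k : Type*} [CommRing k]

/-- Double induction on `n` and `d`, splitting the index sets by whether they contain the last
column. For `n = 0` there are too few columns for a set of size `d`. -/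
theorem eq_zero_of_sum_contract_eq_zero (n d : ℕ) (z : ℕ → Finset ℕ → k)
    (hz : ∀ j < d, ∀ T, z j T ≠ 0 → T ⊆ Finset.range (n + d - 1) ∧ d ≤ T.card)
    (h : ∀ l < n, ∑ j ∈ Finset.range d, contract (l + j) (z j) = 0) :
    ∀ j < d, z j = 0 := by
  induction n generalizing d z with
  | zero =>
    intro j hj
    ext T
    by_contra hT
    obtain ⟨h1, h2⟩ := hz j hj T hT
    have := Finset.card_le_card h1
    rw [Finset.card_range] at this
    omega
  | succ n ihn =>
    induction d generalizing z with
    | zero => intro j hj; omega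
    | succ d ihd =>
      -- The contractions with `l < n` never touch the last column `n + d`, so the parts avoiding it
      -- satisfy the hypotheses for `(n, d + 1)`.
      have hA : ∀ j < d + 1, ∀ T, n + d ∉ T → z j T = 0 := by
        have hA' := ihn (d + 1) (fun j T => if n + d ∈ T then 0 else z j T) ?_ ?_
        · intro j hj T hT
          simpa [hT] using congrFun (hA' j hj) T
        · intro j hj T hT
          by_cases hm : n + d ∈ T
          · simp [hm] at hT
          · simp only [hm, if_false] at hT
            obtain ⟨h1, h2⟩ := hz j hj T hT
            refine ⟨fun t ht => ?_, h2⟩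
            have := Finset.mem_range.1 (h1 ht)
            have : t ≠ n + d := by rintro rfl; exact hm ht
            rw [Finset.mem_range]
            omega
        · intro l hl
          ext T
          rw [Finset.sum_apply]
          by_cases hm : n + d ∈ T
          · refine Finset.sum_eq_zero fun j _ => ?_
            simp [contract_apply, hm]
          · have := congrFun (h l (by omega)) T
            rw [Finset.sum_apply] at this
            rw [← this]
            refine Finset.sum_congr rfl fun j hj => ?_
            have hj := Finset.mem_range.1 hj
            have : n + d ∉ insert (l + j) T := by
              simp only [Finset.mem_insert, hm, or_false]
              omega
            simp [contract_apply, this]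
      -- In the equation for `l = n`, at sets avoiding column `n + d`, only `j = d` contracts that
      -- column; the other terms vanish by `hA`.
      have hd : z d = 0 := by
        have hd' : ∀ T, n + d ∉ T → z d (insert (n + d) T) = 0 := by
          intro T hT
          have := congrFun (h n (by omega)) T
          rw [Finset.sum_apply, Finset.sum_range_succ, Finset.sum_eq_zero, zero_add,
            contract_apply_of_notMem hT] at this
          · exact (IsUnit.mul_right_eq_zero (IsUnit.pow _ isUnit_one.neg)).1 this
          · intro j hj
            have hj := Finset.mem_range.1 hj
            by_cases hm : n + j ∈ T
            · exact contract_apply_of_mem hm _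
            · rw [contract_apply_of_notMem hm, hA j (by omega), mul_zero]
              simp only [Finset.mem_insert, hT, or_false]
              omega
        ext T
        by_cases hT : n + d ∈ T
        · rw [← Finset.insert_erase hT]
          exact hd' _ (Finset.notMem_erase _ _)
        · exact hA d (by omega) T hT
      -- Removing the last column from the sets containing it leaves the problem for `(n + 1, d)`:
      -- one column, one row and one element of each set fewer.
      have hB := ihd (fun j T => if n + d ∈ T then 0 else z j (insert (n + d) T)) ?_ ?_
      · intro j hj
        rcases Nat.lt_succ_iff_lt_or_eq.1 hj with hj' | rfl
        · ext T
          by_cases hT : n + d ∈ T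
          · have := congrFun (hB j hj') (T.erase (n + d))
            simpa [Finset.insert_erase hT] using this
          · exact hA j hj T hT
        · exact hd
      · intro j hj T hT
        by_cases hm : n + d ∈ T
        · simp [hm] at hT
        · simp only [hm, if_false] at hT
          obtain ⟨h1, h2⟩ := hz j (by omega) _ hT
          rw [Finset.card_insert_of_notMem hm] at h2
          refine ⟨fun t ht => ?_, by omega⟩
          have := Finset.mem_range.1 (h1 (Finset.mem_insert_of_mem ht))
          have : t ≠ n + d := by rintro rfl; exact hm ht
          rw [Finset.mem_range]
          omega
      · intro l hl
        ext T
        rw [Finset.sum_apply]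
        by_cases hm : n + d ∈ T
        · refine Finset.sum_eq_zero fun j _ => ?_
          simp [contract_apply, hm]
        · have := congrFun (h l hl) (insert (n + d) T)
          rw [Finset.sum_range_succ, hd, map_zero, add_zero, Finset.sum_apply] at this
          refine Eq.trans ?_ this
          refine Finset.sum_congr rfl fun j hj => ?_
          have hj := Finset.mem_range.1 hj
          have h1 : n + d ≠ l + j := by omega
          have h2 : ¬ n + d < l + j := by omega
          simp [contract_apply, hm, h1, h1.symm, Finset.filter_insert, h2,
            Finset.insert_comm (n + d)]

/-- The elements of degree `i` of the total space of the linear strand of `M^{n,d}`. -/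
def IsStrandForm (n d i : ℕ) (z : (Fin d → ℕ) → Finset ℕ → k) : Prop :=
  ∀ p T, z p T ≠ 0 → ∑ j, p j = i ∧ T ⊆ Finset.range (n + d - 1) ∧ T.card = d + i

/-- An exponent `p` of positive degree is `q + ε_j` for some `q`. At `q`, the vanishing of
`enContract l z` is a system for the components `z (q + ε_j')`, to which the previous lemma applies.
-/
theorem IsStrandForm.eq_zero_of_enContract {n d i : ℕ} {z : (Fin d → ℕ) → Finset ℕ → k}
    (hz : IsStrandForm n d (i + 1) z) (h : ∀ l < n, enContract l z = 0) : z = 0 := by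
  ext p T
  by_contra hT
  obtain ⟨h1, -, -⟩ := hz p T hT
  obtain ⟨j, -, hj⟩ : ∃ j ∈ Finset.univ, p j ≠ 0 :=
    Finset.exists_ne_zero_of_sum_ne_zero (by rw [h1]; omega)
  have hp : p - Pi.single j 1 + Pi.single j 1 = p := by
    refine tsub_add_cancel_of_le fun l => ?_
    by_cases hl : l = j
    · subst hl; simpa using Nat.one_le_iff_ne_zero.2 hj
    · simp [hl]
  have := eq_zero_of_sum_contract_eq_zero n d
    (fun j' => if h : j' < d then z (p - Pi.single j 1 + Pi.single ⟨j', h⟩ 1) else 0) ?_ ?_ j j.2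
  · simp only [j.2, dif_pos, hp] at this
    exact hT (congrFun this T)
  · intro j' hj' T' hT'
    simp only [hj', dif_pos] at hT'
    obtain ⟨-, h2, h3⟩ := hz _ _ hT'
    exact ⟨h2, by omega⟩
  · intro l hl
    rw [Finset.sum_range]
    simpa [enContract_apply] using congrFun (h l hl) (p - Pi.single j 1)

end Socle

/-! ### Dimension count by leading coefficients. -/

section Leading

variable {k V Y ι : Type*} [Field k] [AddCommGroup V] [Module k V] [AddCommGroup Y] [Module k Y]
  [LinearOrder ι]

/-- The elements of `U` on which the maps `c_v` with `v ∈ s`, `v < u` vanish. -/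
def leadingPart (c : ι → V →ₗ[k] Y) (s : Finset ι) (U : Submodule k V) (u : ι) :
    Submodule k V where
  carrier := {x | x ∈ U ∧ ∀ v ∈ s, v < u → c v x = 0}
  zero_mem' := ⟨U.zero_mem, fun v _ _ => map_zero _⟩
  add_mem' := fun ha hb => ⟨U.add_mem ha.1 hb.1, fun v hv hvu => by
    rw [map_add, ha.2 v hv hvu, hb.2 v hv hvu, add_zero]⟩
  smul_mem' := fun a x hx => ⟨U.smul_mem a hx.1, fun v hv hvu => by
    rw [map_smul, hx.2 v hv hvu, smul_zero]⟩

theorem mem_leadingPart {c : ι → V →ₗ[k] Y} {s : Finset ι} {U : Submodule k V} {u : ι} {x : V} :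
    x ∈ leadingPart c s U u ↔ x ∈ U ∧ ∀ v ∈ s, v < u → c v x = 0 := Iff.rfl

/-- The kernels of the first few maps `c v` form a filtration of `U`. By rank-nullity each
successive quotient is the image of the next map, and the last kernel is zero by `h`. -/
theorem finrank_eq_sum_leadingPart (c : ι → V →ₗ[k] Y) (s : Finset ι) (U : Submodule k V)
    [FiniteDimensional k U] (h : ∀ x ∈ U, (∀ v ∈ s, c v x = 0) → x = 0) :
    Module.finrank k U =
      ∑ u ∈ s, Module.finrank k ((leadingPart c s U u).map (c u)) := by
  have key : ∀ s : Finset ι, ∀ K : Submodule k V, (∀ x, x ∈ K ↔ x ∈ U ∧ ∀ v ∈ s, c v x = 0) →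
      Module.finrank k U = Module.finrank k K +
        ∑ u ∈ s, Module.finrank k ((leadingPart c s U u).map (c u)) := by
    intro s
    induction s using Finset.induction_on_max with
    | empty =>
      intro K hK
      have : K = U := by ext x; simp [hK]
      subst this
      simp
    | insert a s hs ih =>
      intro K hK
      have ha : a ∉ s := fun h => lt_irrefl _ (hs a h)
      let L := leadingPart c s U a
      have hL : ∀ x, x ∈ L ↔ x ∈ U ∧ ∀ v ∈ s, c v x = 0 := fun x =>
        ⟨fun hx => ⟨hx.1, fun v hv => hx.2 v hv (hs v hv)⟩, fun hx => ⟨hx.1, fun v hv _ => hx.2 v hv⟩⟩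
      have hLU : L ≤ U := fun x hx => hx.1
      have : FiniteDimensional k L := Submodule.finiteDimensional_of_le hLU
      have h1 : leadingPart c (insert a s) U a = L := by
        ext x
        simp [L, mem_leadingPart]
      have h2 : ∀ u ∈ s, leadingPart c (insert a s) U u = leadingPart c s U u := by
        intro u hu
        ext x
        simp [mem_leadingPart, (hs u hu).not_gt]
      have h3 := LinearMap.finrank_range_add_finrank_ker ((c a).domRestrict L)
      have h4 : ((c a).domRestrict L).range = L.map (c a) := by
        ext y
        simp
      have h5 : ((c a).domRestrict L).ker.map L.subtype = K := by
        ext x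
        simp only [Submodule.mem_map, LinearMap.mem_ker, LinearMap.domRestrict_apply,
          Submodule.subtype_apply, Subtype.exists, exists_and_right, exists_eq_right, hK,
          Finset.mem_insert, forall_eq_or_imp]
        constructor
        · rintro ⟨hx, hx'⟩
          exact ⟨((hL x).1 hx).1, hx', ((hL x).1 hx).2⟩
        · rintro ⟨hx, hx', hx''⟩
          exact ⟨(hL x).2 ⟨hx, hx''⟩, hx'⟩
      have h6 : Module.finrank k ((c a).domRestrict L).ker = Module.finrank k K := by
        rw [← h5]
        exact (LinearEquiv.finrank_eq
          (Submodule.equivMapOfInjective L.subtype L.subtype_injective _))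
      have h7 : ∑ u ∈ s, Module.finrank k ((leadingPart c (insert a s) U u).map (c u)) =
          ∑ u ∈ s, Module.finrank k ((leadingPart c s U u).map (c u)) :=
        Finset.sum_congr rfl fun u hu => by rw [h2 u hu]
      rw [ih L hL, Finset.sum_insert ha, h1, h7, ← h3, h4, h6]
      ring
  rw [key s ⊥ fun x => ?_, finrank_bot, zero_add]
  rw [Submodule.mem_bot]
  exact ⟨fun hx => by subst hx; simp, fun hx => h x hx.1 hx.2⟩

end Leading

/-! ### Maximal minors of `M^{n,d}` and the Koszul cycle relation. -/

section Minors

variable (k : Type*) [Field k] (n : ℕ)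

/-- The entries of the matrix `M^{n,d}`, with columns numbered by all natural numbers. -/
noncomputable def stripEntry (j s : ℕ) : MvPolynomial (Fin n) k :=
  if h : j ≤ s ∧ s - j < n then MvPolynomial.X ⟨s - j, h.2⟩ else 0

/-- The maximal minor of `M^{n,d}` on a set of columns (and `0` for sets of the wrong size). -/
noncomputable def stripMinor (d : ℕ) (T : Finset ℕ) : MvPolynomial (Fin n) k :=
  if h : T.card = d then
    (Matrix.of fun a b : Fin d => stripEntry k n a (T.orderEmbOfFin h b)).det
  else 0

variable {k n}

theorem stripEntry_add (j : ℕ) (l : Fin n) : stripEntry k n j (l + j) = MvPolynomial.X l := by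
  rw [stripEntry, dif_pos ⟨by omega, by simp⟩]
  congr 1
  ext
  simp

theorem card_filter_lt_orderEmbOfFin {m : ℕ} {U : Finset ℕ} (h : U.card = m) (q : Fin m) :
    (U.filter (· < U.orderEmbOfFin h q)).card = q := by
  have : U.filter (· < U.orderEmbOfFin h q) =
      (Finset.Iio q).map (U.orderEmbOfFin h).toEmbedding := by
    ext t
    simp only [Finset.mem_filter, Finset.mem_map, Finset.mem_Iio, RelEmbedding.coe_toEmbedding]
    constructor
    · rintro ⟨ht, htq⟩
      obtain ⟨a, rfl⟩ : t ∈ Set.range (U.orderEmbOfFin h) := by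
        rw [Finset.range_orderEmbOfFin]; exact ht
      exact ⟨a, by simpa using htq, rfl⟩
    · rintro ⟨a, ha, rfl⟩
      exact ⟨Finset.orderEmbOfFin_mem _ _ _, by simpa using ha⟩
  rw [this, Finset.card_map, Fin.card_Iio]

theorem orderEmbOfFin_erase {m : ℕ} {U : Finset ℕ} (h : U.card = m + 1) (q : Fin (m + 1))
    (h' : (U.erase (U.orderEmbOfFin h q)).card = m) (b : Fin m) :
    (U.erase (U.orderEmbOfFin h q)).orderEmbOfFin h' b = U.orderEmbOfFin h (q.succAbove b) := by
  have := Finset.orderEmbOfFin_unique h' (f := fun b => U.orderEmbOfFin h (q.succAbove b))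
    (fun x => by simp [Fin.succAbove_ne])
    ((U.orderEmbOfFin h).strictMono.comp (Fin.strictMono_succAbove q))
  exact (congrFun this b).symm

/-- Laplace expansion of a determinant with a repeated row. -/
theorem sum_stripEntry_mul_stripMinor {d : ℕ} (j : Fin d) {U : Finset ℕ} (hU : U.card = d + 1) :
    ∑ t ∈ U, (-1) ^ (U.filter (· < t)).card * stripEntry k n j t * stripMinor k n d (U.erase t)
      = 0 := by
  let ρ : Fin (d + 1) → Fin d := Fin.cons j fun i => i
  let N : Matrix (Fin (d + 1)) (Fin (d + 1)) (MvPolynomial (Fin n) k) :=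
    Matrix.of fun a b => stripEntry k n (ρ a) (U.orderEmbOfFin hU b)
  have hN : N.det = 0 := by
    refine Matrix.det_zero_of_row_eq (i := 0) (j := j.succ) (Fin.succ_ne_zero j).symm ?_
    ext1 b
    simp [N, ρ]
  rw [Matrix.det_succ_row_zero] at hN
  have hsum : ∀ g : ℕ → MvPolynomial (Fin n) k,
      ∑ t ∈ U, g t = ∑ q, g (U.orderEmbOfFin hU q) := by
    intro g
    conv_lhs => rw [← Finset.map_orderEmbOfFin_univ U hU, Finset.sum_map]
    rfl
  rw [← hN, hsum]
  refine Finset.sum_congr rfl fun q _ => ?_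
  have hcard : (U.erase (U.orderEmbOfFin hU q)).card = d := by
    rw [Finset.card_erase_of_mem (Finset.orderEmbOfFin_mem _ _ _), hU]; rfl
  rw [card_filter_lt_orderEmbOfFin, stripMinor, dif_pos hcard]
  congr 2
  ext a b : 2
  simp [N, ρ, orderEmbOfFin_erase]

/-- The map from the degree zero part of the strand to the polynomials of degree `d`. -/
noncomputable def minorForm (n d : ℕ) :
    ((Fin d → ℕ) → Finset ℕ → k) →ₗ[k] MvPolynomial (Fin n) k where
  toFun z := ∑ T ∈ (Finset.range (n + d - 1)).powersetCard d, z 0 T • stripMinor k n d T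
  map_add' v w := by simp [add_smul, Finset.sum_add_distrib]
  map_smul' c w := by simp [Finset.smul_sum, smul_smul]

theorem minorForm_apply (d : ℕ) (z : (Fin d → ℕ) → Finset ℕ → k) :
    minorForm n d z =
      ∑ T ∈ (Finset.range (n + d - 1)).powersetCard d, z 0 T • stripMinor k n d T := rfl

theorem sum_contract_smul_eq_zero {d : ℕ} (j : Fin d) (w : Finset ℕ → k) (N : ℕ) :
    ∑ T ∈ (Finset.range N).powersetCard d, ∑ s ∈ Finset.range N,
      contract s w T • (stripEntry k n j s * stripMinor k n d T) = 0 := by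
  have h1 : ∀ U ∈ (Finset.range N).powersetCard (d + 1),
      ∑ t ∈ U, ((-1) ^ (U.filter (· < t)).card * w U) •
        (stripEntry k n j t * stripMinor k n d (U.erase t)) = 0 := by
    intro U hU
    rw [← smul_zero (w U), ← sum_stripEntry_mul_stripMinor (k := k) (n := n) j
      (Finset.mem_powersetCard.1 hU).2, Finset.smul_sum]
    refine Finset.sum_congr rfl fun t _ => ?_
    rw [mul_comm, ← smul_smul]
    congr 1
    rw [mul_assoc, MvPolynomial.smul_eq_C_mul, map_pow, map_neg, map_one]
  rw [← Finset.sum_eq_zero h1, Finset.sum_sigma', Finset.sum_sigma']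
  symm
  -- A pair `t ∈ U` corresponds to the pair `(U ∖ t, t)`; the pairs `(T, s)` missed have `s ∈ T`,
  -- where the contraction is zero.
  refine Finset.sum_of_injOn (fun x => ⟨x.1.erase x.2, x.2⟩) ?_ ?_ ?_ ?_
  · rintro ⟨U, t⟩ hU ⟨U', t'⟩ hU' h
    simp only [Finset.coe_sigma, Set.mem_sigma_iff, Finset.mem_coe] at hU hU'
    simp only [Sigma.mk.injEq, heq_eq_eq] at h
    obtain ⟨h1, rfl⟩ := h
    have : U = U' := by rw [← Finset.insert_erase hU.2, h1, Finset.insert_erase hU'.2]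
    rw [this]
  · rintro ⟨U, t⟩ hU
    simp only [Finset.coe_sigma, Set.mem_sigma_iff, Finset.mem_coe, Finset.mem_powersetCard]
      at hU ⊢
    refine ⟨⟨(Finset.erase_subset _ _).trans hU.1.1, ?_⟩, hU.1.1 hU.2⟩
    rw [Finset.card_erase_of_mem hU.2, hU.1.2]; rfl
  · rintro ⟨T, s⟩ hT hT'
    simp only [Finset.mem_sigma, Finset.mem_powersetCard] at hT
    by_cases hs : s ∈ T
    · rw [contract_apply_of_mem hs, zero_smul]
    · refine (hT' ⟨⟨insert s T, s⟩, ?_, ?_⟩).elim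
      · simp only [Finset.coe_sigma, Set.mem_sigma_iff, Finset.mem_coe, Finset.mem_powersetCard,
          Finset.mem_insert_self, and_true, Finset.card_insert_of_notMem hs, hT.1.2]
        exact Finset.insert_subset hT.2 hT.1.1
      · simp [Finset.erase_insert hs]
  · rintro ⟨U, t⟩ hU
    simp only [Finset.mem_sigma] at hU
    rw [contract_apply_of_notMem (Finset.notMem_erase _ _), Finset.insert_erase hU.2]
    congr 3
    rw [Finset.filter_erase, Finset.erase_eq_of_notMem (by simp)]

/-- In row `j` the entry in column `l + j` is `x_l`, so the sum collects, for each `j`, Laplace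
expansions of determinants with row `j` repeated. Thus the minors annihilate the image of the first
Eagon–Northcott differential. -/
theorem sum_X_mul_minorForm_enContract (d : ℕ) (z : (Fin d → ℕ) → Finset ℕ → k) :
    ∑ l : Fin n, MvPolynomial.X l * minorForm n d (enContract (l : ℕ) z) = 0 := by
  have h : ∀ j : Fin d, ∑ l : Fin n, ∑ T ∈ (Finset.range (n + d - 1)).powersetCard d,
      contract (l + j : ℕ) (z (0 + Pi.single j 1)) T •
        (MvPolynomial.X l * stripMinor k n d T) = 0 := by
    intro j
    rw [← sum_contract_smul_eq_zero j (z (0 + Pi.single j 1)) (n + d - 1), Finset.sum_comm]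
    refine Finset.sum_congr rfl fun T _ => ?_
    refine Finset.sum_of_injOn (fun l : Fin n => (l + j : ℕ)) ?_ ?_ ?_ ?_
    · intro l _ l' _ h
      simpa [Fin.ext_iff] using h
    · intro l _
      simp only [Finset.coe_range, Set.mem_Iio]
      omega
    · intro s _ hs
      rw [stripEntry, dif_neg, zero_mul, smul_zero]
      rintro ⟨h1, h2⟩
      exact hs ⟨⟨s - j, h2⟩, by simp, by simp; omega⟩
    · intro l _
      rw [stripEntry_add]
  rw [← Finset.sum_eq_zero fun j (_ : j ∈ Finset.univ) => h j, Finset.sum_comm]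
  refine Finset.sum_congr rfl fun l _ => ?_
  rw [Finset.sum_comm, minorForm_apply, Finset.mul_sum]
  refine Finset.sum_congr rfl fun T _ => ?_
  rw [enContract_apply, Finset.sum_apply, Finset.sum_smul, Finset.mul_sum]
  exact Finset.sum_congr rfl fun j _ => mul_smul_comm _ _ _

theorem exists_of_coeff_prod_stripEntry_ne_zero {d : ℕ} {f g : Fin d → ℕ} {v : Fin n →₀ ℕ}
    (h : MvPolynomial.coeff v (∏ a, stripEntry k n (f a) (g a)) ≠ 0) :
    ∃ x : Fin d → Fin n, (∀ a, g a = x a + f a) ∧ v = ∑ a, Finsupp.single (x a) 1 := by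
  have h1 : ∀ a, ∃ l : Fin n, g a = l + f a := by
    intro a
    by_contra ha
    apply h
    rw [Finset.prod_eq_zero (Finset.mem_univ a), MvPolynomial.coeff_zero]
    rw [stripEntry, dif_neg]
    rintro ⟨h1, h2⟩
    exact ha ⟨⟨g a - f a, h2⟩, by simp; omega⟩
  choose x hx using h1
  refine ⟨x, hx, ?_⟩
  simp only [hx, stripEntry_add] at h
  by_contra hv
  apply h
  have : ∏ a, (MvPolynomial.X (x a) : MvPolynomial (Fin n) k) =
      MvPolynomial.monomial (∑ a, Finsupp.single (x a) 1) 1 := by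
    rw [MvPolynomial.monomial_sum_one]; rfl
  rw [this, MvPolynomial.coeff_monomial, if_neg (Ne.symm hv)]

end Minors

/-! ### Linear independence of the maximal minors. -/

section LinearIndependence

theorem eq_of_monotone_of_sum_single_eq {d n : ℕ} {x y : Fin d → Fin n} (hx : Monotone x)
    (hy : Monotone y)
    (h : ∑ a, Finsupp.single (x a) 1 = ∑ a, Finsupp.single (y a) 1) : x = y := by
  have h1 : ∀ z : Fin d → Fin n,
      Finsupp.toMultiset (∑ a, Finsupp.single (z a) 1) = (List.ofFn z : Multiset (Fin n)) := by
    intro z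
    rw [← Fin.univ_val_map, map_sum]
    simp only [Finsupp.toMultiset_single, one_smul]
    have := Multiset.sum_map_singleton (Finset.univ.val.map z)
    rwa [Multiset.map_map] at this
  have h2 := congrArg Finsupp.toMultiset h
  rw [h1, h1, Multiset.coe_eq_coe] at h2
  exact List.ofFn_injective (h2.eq_of_pairwise' (List.sortedLE_ofFn_iff.2 hx).pairwise
    (List.sortedLE_ofFn_iff.2 hy).pairwise)

/-- After expanding the squares this is the strict rearrangement inequality for `∑ e a * σ a`. -/
theorem sum_sq_lt_sum_sub_perm_sq {d : ℕ} {e : Fin d → ℕ} (he : StrictMono e)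
    {σ : Equiv.Perm (Fin d)} (hσ : σ ≠ 1) :
    ∑ a, ((e a : ℤ) - (a : ℕ)) ^ 2 < ∑ a, ((e a : ℤ) - (σ a : ℕ)) ^ 2 := by
  have h1 : Monovary (fun a => (e a : ℤ)) (fun a : Fin d => ((a : ℕ) : ℤ)) := by
    intro a b hab
    have : a < b := by simpa using hab
    exact Int.ofNat_le.2 (he this).le
  have h2 := (h1.sum_mul_comp_perm_lt_sum_mul_iff (σ := σ)).2 ?_
  · have h3 : ∑ a, (((σ a : Fin d) : ℕ) : ℤ) ^ 2 = ∑ a : Fin d, ((a : ℕ) : ℤ) ^ 2 :=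
      Equiv.sum_comp σ fun a => ((a : ℕ) : ℤ) ^ 2
    simp only [sub_sq, Finset.sum_add_distrib, Finset.sum_sub_distrib, h3, mul_assoc,
      ← Finset.mul_sum]
    linarith
  · intro hm
    apply hσ
    -- Equality would make `σ` order preserving, and the only such permutation of `Fin d` is the
    -- identity.
    have hs : StrictMono σ.symm := by
      intro a b hab
      have h4 := hm (i := σ.symm a) (j := σ.symm b) (by simpa using hab)
      have h5 : σ.symm a ≤ σ.symm b := he.le_iff_le.1 (Int.ofNat_le.1 h4)
      exact lt_of_le_of_ne h5 fun h => hab.ne (σ.symm.injective h)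
    have h6 : (hs.orderIsoOfSurjective _ σ.symm.surjective) = OrderIso.refl _ :=
      Subsingleton.elim _ _
    ext a
    have h7 := DFunLike.congr_fun h6 (σ a)
    simp at h7
    simp [← h7]

theorem orderEmbOfFin_add_le {d : ℕ} {T : Finset ℕ} (h : T.card = d) {a b : Fin d} (hab : a ≤ b) :
    T.orderEmbOfFin h a + b ≤ T.orderEmbOfFin h b + a := by
  have h1 : T.filter (· < T.orderEmbOfFin h b) ⊆ T.filter (· < T.orderEmbOfFin h a) ∪
      Finset.Ico (T.orderEmbOfFin h a) (T.orderEmbOfFin h b) := by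
    intro t
    simp only [Finset.mem_filter, Finset.mem_union, Finset.mem_Ico]
    rintro ⟨h1, h2⟩
    by_cases h3 : t < T.orderEmbOfFin h a
    · exact Or.inl ⟨h1, h3⟩
    · exact Or.inr ⟨not_lt.1 h3, h2⟩
  have h2 := (Finset.card_le_card h1).trans (Finset.card_union_le _ _)
  rw [card_filter_lt_orderEmbOfFin, card_filter_lt_orderEmbOfFin, Nat.card_Ico] at h2
  have := (T.orderEmbOfFin h).monotone hab
  omega

theorem exists_orderEmbOfFin_eq_add {n d : ℕ} {T : Finset ℕ} (h : T.card = d)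
    (hT : T ⊆ Finset.range (n + d - 1)) :
    ∃ x : Fin d → Fin n, ∀ a, T.orderEmbOfFin h a = x a + a := by
  have h1 : ∀ a : Fin d, (a : ℕ) ≤ T.orderEmbOfFin h a := by
    intro a
    have : T.filter (· < T.orderEmbOfFin h a) ⊆ Finset.range (T.orderEmbOfFin h a) := by
      intro t ht
      exact Finset.mem_range.2 (Finset.mem_filter.1 ht).2
    simpa [card_filter_lt_orderEmbOfFin] using Finset.card_le_card this
  have h2 : ∀ a : Fin d, T.orderEmbOfFin h a - a < n := by
    intro a
    have h6 := a.2
    let b : Fin d := ⟨d - 1, by omega⟩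
    have hb : (b : ℕ) = d - 1 := rfl
    have h3 := orderEmbOfFin_add_le h (a := a) (b := b) (by rw [Fin.le_def]; omega)
    have h4 := Finset.mem_range.1 (hT (Finset.orderEmbOfFin_mem T h b))
    have h5 := h1 a
    omega
  exact ⟨fun a => ⟨T.orderEmbOfFin h a - a, h2 a⟩, fun a => by
    have := h1 a
    simp only
    omega⟩

theorem monotone_of_orderEmbOfFin_eq_add {n d : ℕ} {T : Finset ℕ} (h : T.card = d)
    {x : Fin d → Fin n} (hx : ∀ a, T.orderEmbOfFin h a = x a + a) : Monotone x := by
  intro a b hab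
  have := orderEmbOfFin_add_le h hab
  rw [hx, hx] at this
  rw [Fin.le_def]
  omega

variable {k : Type*} [Field k]

/-- The sum of the squares of the indices of the variables on the diagonal of a minor. -/
def diagWeight (T : Finset ℕ) : ℤ := ∑ t ∈ T, ((t : ℤ) - (T.filter (· < t)).card) ^ 2

theorem diagWeight_eq {d : ℕ} {T : Finset ℕ} (h : T.card = d) :
    diagWeight T = ∑ a, ((T.orderEmbOfFin h a : ℤ) - (a : ℕ)) ^ 2 := by
  rw [diagWeight]
  conv_lhs => enter [1]; rw [← Finset.map_orderEmbOfFin_univ T h]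
  rw [Finset.sum_map]
  refine Finset.sum_congr rfl fun a _ => ?_
  rw [RelEmbedding.coe_toEmbedding, card_filter_lt_orderEmbOfFin]

/-- Off-diagonal terms of the minor on `T'` have weight larger than `diagWeight T'`, so they cannot
give the diagonal monomial of `T`. A diagonal monomial determines its column set, because its
variables occur in weakly increasing order. -/
theorem eq_of_coeff_prod_ne_zero {n d : ℕ} {T T' : Finset ℕ} (h : T.card = d) (h' : T'.card = d)
    {x : Fin d → Fin n} (hx : ∀ a, T.orderEmbOfFin h a = x a + a)
    (hw : diagWeight T ≤ diagWeight T') {σ : Equiv.Perm (Fin d)}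
    (hne : MvPolynomial.coeff (∑ a, Finsupp.single (x a) 1)
      (∏ a, stripEntry k n (σ a : Fin d) (T'.orderEmbOfFin h' a)) ≠ 0) : σ = 1 ∧ T = T' := by
  obtain ⟨y, hy, hxy⟩ := exists_of_coeff_prod_stripEntry_ne_zero hne
  have hsq : ∑ a, ((x a : ℕ) : ℤ) ^ 2 = ∑ a, ((y a : ℕ) : ℤ) ^ 2 := by
    have := congrArg (Finsupp.weight fun i : Fin n => ((i : ℕ) : ℤ) ^ 2) hxy
    simpa [map_sum, Finsupp.weight_single] using this
  have hσ : σ = 1 := by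
    by_contra hσ
    have h1 := sum_sq_lt_sum_sub_perm_sq (T'.orderEmbOfFin h').strictMono hσ
    rw [← diagWeight_eq h'] at h1
    refine absurd (hw.trans_lt h1) (not_lt.2 (le_of_eq ?_))
    rw [diagWeight_eq h]
    simp only [hx, hy]
    push_cast
    simpa using hsq.symm
  subst hσ
  refine ⟨rfl, ?_⟩
  have hxy' : x = y := eq_of_monotone_of_sum_single_eq (monotone_of_orderEmbOfFin_eq_add h hx)
    (monotone_of_orderEmbOfFin_eq_add h' hy) hxy
  have he : (T.orderEmbOfFin h : Fin d → ℕ) = T'.orderEmbOfFin h' := by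
    ext a
    rw [hx, hy, hxy']
    rfl
  rw [← Finset.coe_inj, ← Finset.range_orderEmbOfFin T h, he, Finset.range_orderEmbOfFin]

/-- The maximal minors of `M^{n,d}` are linearly independent. -/
theorem eq_zero_of_sum_smul_stripMinor_eq_zero {n d : ℕ} (y : Finset ℕ → k)
    (hy : ∑ T ∈ (Finset.range (n + d - 1)).powersetCard d, y T • stripMinor k n d T = 0) :
    ∀ T ∈ (Finset.range (n + d - 1)).powersetCard d, y T = 0 := by
  classical
  by_contra! hcon
  obtain ⟨T₀, hT₀, hyT₀⟩ := hcon
  -- For `T` of least weight in the relation, its diagonal monomial occurs in no other minor of the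
  -- relation.
  obtain ⟨T, hT, hmin⟩ := Finset.exists_min_image
    (((Finset.range (n + d - 1)).powersetCard d).filter (y · ≠ 0)) diagWeight
    ⟨T₀, Finset.mem_filter.2 ⟨hT₀, hyT₀⟩⟩
  obtain ⟨hTp, hyT⟩ := Finset.mem_filter.1 hT
  obtain ⟨hTs, hTc⟩ := Finset.mem_powersetCard.1 hTp
  obtain ⟨x, hx⟩ := exists_orderEmbOfFin_eq_add hTc hTs
  have h1 := congrArg (MvPolynomial.coeff (∑ a, Finsupp.single (x a) 1)) hy
  have hexp : ∀ T' (h' : T'.card = d),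
      MvPolynomial.coeff (∑ a, Finsupp.single (x a) 1) (stripMinor k n d T') =
      ∑ σ : Equiv.Perm (Fin d), ((Equiv.Perm.sign σ : ℤ) : k) *
        MvPolynomial.coeff (∑ a, Finsupp.single (x a) 1)
          (∏ a, stripEntry k n (σ a : Fin d) (T'.orderEmbOfFin h' a)) := by
    intro T' h'
    rw [stripMinor, dif_pos h', Matrix.det_apply', MvPolynomial.coeff_sum]
    refine Finset.sum_congr rfl fun σ _ => ?_
    rw [← MvPolynomial.coeff_C_mul]
    simp
  rw [MvPolynomial.coeff_sum, MvPolynomial.coeff_zero, Finset.sum_eq_single_of_mem T hTp] at h1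
  · rw [MvPolynomial.coeff_smul, hexp T hTc, Finset.sum_eq_single_of_mem 1 (Finset.mem_univ _)] at h1
    · have h2 : ∏ a, stripEntry k n ((1 : Equiv.Perm (Fin d)) a : Fin d) (T.orderEmbOfFin hTc a) =
          MvPolynomial.monomial (∑ a, Finsupp.single (x a) 1) 1 := by
        rw [MvPolynomial.monomial_sum_one]
        refine Finset.prod_congr rfl fun a _ => ?_
        rw [hx a]
        exact stripEntry_add _ _
      rw [h2, MvPolynomial.coeff_monomial, if_pos rfl] at h1
      simp at h1
      exact hyT h1
    · intro σ _ hσ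
      by_contra hne
      exact hσ (eq_of_coeff_prod_ne_zero hTc hTc hx le_rfl (right_ne_zero_of_mul hne)).1
  · intro T' hT' hne
    by_cases hyT' : y T' = 0
    · simp [hyT']
    · have hTc' := (Finset.mem_powersetCard.1 hT').2
      rw [MvPolynomial.coeff_smul, hexp T' hTc', Finset.sum_eq_zero, smul_zero]
      intro σ _
      by_contra hne'
      exact hne (eq_of_coeff_prod_ne_zero hTc hTc' hx
        (hmin T' (Finset.mem_filter.2 ⟨hT', hyT'⟩)) (right_ne_zero_of_mul hne')).2.symm

end LinearIndependence

/-! ### Koszul cycles of strand elements and their leading coefficients. -/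

section LeadingForms

variable {k : Type*} [Field k] {n d : ℕ}

theorem neg_one_pow_mul_apply {M : Type*} [AddCommGroup M] [Module k M] (m : ℕ)
    (f : Module.End k M) (z : M) : ((-1) ^ m * f) z = (-1 : k) ^ m • f z := by
  rcases Nat.even_or_odd m with h | h
  · rw [h.neg_one_pow, h.neg_one_pow]
    simp
  · rw [h.neg_one_pow, h.neg_one_pow]
    simp

/-- The composite of the contractions `enContract l` for `l ∈ I`, `l < n`. -/
noncomputable def enContractProd (n : ℕ) (I : Finset ℕ) :
    Module.End k ((Fin d → ℕ) → Finset ℕ → k) :=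
  descProd (A := Module.End k ((Fin d → ℕ) → Finset ℕ → k)) (fun l => enContract l) n I

theorem enContractProd_enContract {l : ℕ} (hl : l < n) (I : Finset ℕ)
    (z : (Fin d → ℕ) → Finset ℕ → k) :
    enContractProd n I (enContract l z) =
      if l ∈ I then 0 else (-1 : k) ^ (I.filter (· < l)).card • enContractProd n (insert l I) z := by
  have h := descProd_mul (A := Module.End k ((Fin d → ℕ) → Finset ℕ → k))
    (D := fun l => enContract l)
    (fun l m => LinearMap.ext fun z => enContract_enContract l m z)
    (fun l => LinearMap.ext fun z => enContract_enContract_self l z) hl I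
  have h' := LinearMap.congr_fun h z
  refine h'.trans ?_
  split_ifs
  · rfl
  · exact neg_one_pow_mul_apply _ _ _

theorem enContractProd_enContract_comm (l : ℕ) (I : Finset ℕ)
    (z : (Fin d → ℕ) → Finset ℕ → k) :
    enContract l (enContractProd n I z) =
      (-1 : k) ^ (I.filter (· < n)).card • enContractProd n I (enContract l z) := by
  have h := descProd_mul_comm (A := Module.End k ((Fin d → ℕ) → Finset ℕ → k))
    (D := fun l => enContract l)
    (fun l m => LinearMap.ext fun z => enContract_enContract l m z) n l I
  have h' : enContractProd n I (enContract l z) = _ := LinearMap.congr_fun h z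
  rw [h', neg_one_pow_mul_apply, smul_smul, ← mul_pow, neg_one_mul, neg_neg, one_pow, one_smul]
  rfl

theorem enContractProd_empty (z : (Fin d → ℕ) → Finset ℕ → k) : enContractProd n ∅ z = z := by
  have : ∀ r, descProd (A := Module.End k ((Fin d → ℕ) → Finset ℕ → k))
      (fun l => enContract l) r ∅ = 1 := by
    intro r
    induction r with
    | zero => rfl
    | succ r ih => simp [descProd, ih]
  rw [enContractProd, this]
  rfl

/-- The coefficients of a monomial `u` in the Koszul cycle attached to an element of degree `i`
of the linear strand. -/
noncomputable def cycleCoeff (n d i : ℕ) (u : Fin n →₀ ℕ) :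
    ((Fin d → ℕ) → Finset ℕ → k) →ₗ[k] (Finset ℕ → k) where
  toFun z I := if I ⊆ Finset.range n ∧ I.card = i then
    MvPolynomial.coeff u (minorForm n d (enContractProd n I z)) else 0
  map_add' v w := by
    ext I
    by_cases h : I ⊆ Finset.range n ∧ I.card = i <;> simp [h]
  map_smul' c w := by
    ext I
    by_cases h : I ⊆ Finset.range n ∧ I.card = i <;> simp [h]

theorem cycleCoeff_apply (i : ℕ) (u : Fin n →₀ ℕ) (z : (Fin d → ℕ) → Finset ℕ → k)
    (I : Finset ℕ) : cycleCoeff n d i u z I = if I ⊆ Finset.range n ∧ I.card = i then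
    MvPolynomial.coeff u (minorForm n d (enContractProd n I z)) else 0 := rfl

theorem cycleCoeff_enContract (i : ℕ) (u : Fin n →₀ ℕ) {l : ℕ} (hl : l < n)
    (z : (Fin d → ℕ) → Finset ℕ → k) :
    cycleCoeff n d i u (enContract l z) = contract l (cycleCoeff n d (i + 1) u z) := by
  ext I
  rw [cycleCoeff_apply, enContractProd_enContract hl]
  by_cases h : l ∈ I
  · rw [contract_apply_of_mem h, if_pos h]
    simp
  · have h1 : (insert l I ⊆ Finset.range n ∧ (insert l I).card = i + 1) ↔
        (I ⊆ Finset.range n ∧ I.card = i) := by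
      rw [Finset.insert_subset_iff, Finset.card_insert_of_notMem h, Finset.mem_range]
      simp [hl]
    rw [contract_apply_of_notMem h, if_neg h, cycleCoeff_apply]
    simp only [h1, map_smul, MvPolynomial.coeff_smul, smul_eq_mul, mul_ite, mul_zero]

theorem IsStrandForm.enContract {i l : ℕ} {z : (Fin d → ℕ) → Finset ℕ → k}
    (hz : IsStrandForm n d (i + 1) z) : IsStrandForm n d i (enContract l z) := by
  intro p T h
  rw [enContract_apply, Finset.sum_apply] at h
  obtain ⟨j, -, hj⟩ := Finset.exists_ne_zero_of_sum_ne_zero h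
  by_cases hT : l + j ∈ T
  · exact absurd (contract_apply_of_mem hT _) hj
  · rw [contract_apply_of_notMem hT] at hj
    obtain ⟨h1, h2, h3⟩ := hz _ _ (right_ne_zero_of_mul hj)
    rw [Finset.card_insert_of_notMem hT] at h3
    refine ⟨?_, (Finset.subset_insert _ _).trans h2, by omega⟩
    simpa [Finset.sum_add_distrib] using h1

/-- Induction on degree: each `enContract l z` has vanishing coefficients too, so it is zero, and
there is no socle in positive degree. Degree 0 is the independence of the minors. -/
theorem IsStrandForm.eq_zero_of_cycleCoeff {i : ℕ} {z : (Fin d → ℕ) → Finset ℕ → k}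
    (hz : IsStrandForm n d i z) (h : ∀ u, cycleCoeff n d i u z = 0) : z = 0 := by
  induction i generalizing z with
  | zero =>
    have h1 : minorForm n d z = 0 := by
      ext u
      have := congrFun (h u) ∅
      simpa [cycleCoeff_apply, enContractProd_empty] using this
    have h2 := eq_zero_of_sum_smul_stripMinor_eq_zero (n := n) (d := d) (z 0) h1
    ext p T
    by_contra hne
    obtain ⟨h3, h4, h5⟩ := hz p T hne
    have hp : p = 0 := by
      ext j
      exact (Finset.sum_eq_zero_iff.1 h3) j (Finset.mem_univ j)
    subst hp
    exact hne (h2 T (Finset.mem_powersetCard.2 ⟨h4, by omega⟩))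
  | succ i ih =>
    refine hz.eq_zero_of_enContract fun l hl => ih hz.enContract fun u => ?_
    rw [cycleCoeff_enContract i u hl, h u, map_zero]

theorem degree_eq_of_coeff_minorForm_ne_zero {u : Fin n →₀ ℕ} {z : (Fin d → ℕ) → Finset ℕ → k}
    (h : MvPolynomial.coeff u (minorForm n d z) ≠ 0) : ∑ t, u t = d := by
  rw [minorForm_apply, MvPolynomial.coeff_sum] at h
  obtain ⟨T, hT, h1⟩ := Finset.exists_ne_zero_of_sum_ne_zero h
  rw [MvPolynomial.coeff_smul, stripMinor, dif_pos (Finset.mem_powersetCard.1 hT).2,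
    Matrix.det_apply, MvPolynomial.coeff_sum] at h1
  obtain ⟨σ, -, h2⟩ := Finset.exists_ne_zero_of_sum_ne_zero (right_ne_zero_of_mul h1)
  have h3 : MvPolynomial.coeff u (∏ a, stripEntry k n (σ a : Fin d)
      (T.orderEmbOfFin (Finset.mem_powersetCard.1 hT).2 a)) ≠ 0 := by
    intro h4
    apply h2
    rcases Int.units_eq_one_or (Equiv.Perm.sign σ) with h5 | h5 <;> simpa [h5] using h4
  obtain ⟨x, -, rfl⟩ := exists_of_coeff_prod_stripEntry_ne_zero h3
  simp only [Finsupp.finsetSum_apply]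
  rw [Finset.sum_comm]
  simp [Finsupp.single_apply]

/-- This lets the finite set `lexMonomials n d` stand for all monomials. -/
theorem cycleCoeff_eq_zero_of_degree_ne {i : ℕ} {u : Fin n →₀ ℕ} (hu : ∑ t, u t ≠ d)
    (z : (Fin d → ℕ) → Finset ℕ → k) : cycleCoeff n d i u z = 0 := by
  ext I
  rw [cycleCoeff_apply]
  split_ifs
  · by_contra h
    exact hu (degree_eq_of_coeff_minorForm_ne_zero h)
  · rfl

/-- The leading coefficient of a Koszul cycle does not involve the last variable of the leading
monomial, nor any later variable. -/
theorem cycleCoeff_eq_zero_of_mem {i : ℕ} {u : Fin n →₀ ℕ} {z : (Fin d → ℕ) → Finset ℕ → k}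
    (h : ∀ v : Fin n →₀ ℕ, toLex v < toLex u → cycleCoeff n d i v z = 0)
    {I : Finset ℕ} {l : ℕ} (hl : l ∈ I) (hu : ∀ t ∈ u.support, (t : ℕ) ≤ l) :
    cycleCoeff n d i u z I = 0 := by
  by_cases hI : I ⊆ Finset.range n ∧ I.card = i
  swap
  · rw [cycleCoeff_apply, if_neg hI]
  have hln : l < n := Finset.mem_range.1 (hI.1 hl)
  obtain ⟨i, rfl⟩ : ∃ i', i = i' + 1 := ⟨i - 1, by
    have := Finset.card_pos.2 ⟨l, hl⟩
    omega⟩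
  have hJ : I.erase l ⊆ Finset.range n ∧ (I.erase l).card = i :=
    ⟨(Finset.erase_subset _ _).trans hI.1, by rw [Finset.card_erase_of_mem hl, hI.2]; rfl⟩
  have hcomm : ∀ (t : Fin n) v, MvPolynomial.coeff v
      (minorForm n d (enContract (t : ℕ) (enContractProd n (I.erase l) z))) =
        (-1) ^ ((I.erase l).filter (· < n)).card *
          contract t (cycleCoeff n d (i + 1) v z) (I.erase l) := by
    intro t v
    rw [enContractProd_enContract_comm, map_smul, MvPolynomial.coeff_smul, smul_eq_mul,
      ← cycleCoeff_enContract i v t.2, cycleCoeff_apply, if_pos hJ]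
  -- The coefficient of `u * x_l` in the cycle relation: the term of `x_l` gives, up to sign, the
  -- coefficient sought, and all other terms vanish.
  have h1 := congrArg (MvPolynomial.coeff (u + Finsupp.single ⟨l, hln⟩ 1))
    (sum_X_mul_minorForm_enContract (n := n) d (enContractProd n (I.erase l) z))
  rw [MvPolynomial.coeff_sum, MvPolynomial.coeff_zero,
    Finset.sum_eq_single_of_mem ⟨l, hln⟩ (Finset.mem_univ _)] at h1
  · rw [MvPolynomial.coeff_X_mul', if_pos (by simp), add_tsub_cancel_right, hcomm,
      IsUnit.mul_right_eq_zero (IsUnit.pow _ isUnit_one.neg),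
      contract_apply_of_notMem (Finset.notMem_erase _ _), Finset.insert_erase hl,
      IsUnit.mul_right_eq_zero (IsUnit.pow _ isUnit_one.neg)] at h1
    exact h1
  · intro t _ ht
    rw [MvPolynomial.coeff_X_mul']
    split_ifs with hts
    · have hut : u t ≠ 0 := by
        simpa [Finsupp.single_apply, Ne.symm ht] using hts
      -- As `t` comes before `l`, the monomial `u * x_l / x_t` has a smaller exponent at `t` and
      -- agrees with `u` before it, so it is lexicographically smaller than `u`.
      have htl : t < ⟨l, hln⟩ :=
        lt_of_le_of_ne (hu t (Finsupp.mem_support_iff.2 hut)) ht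
      rw [hcomm, h, map_zero, Pi.zero_apply, mul_zero]
      rw [Finsupp.Lex.lt_iff]
      refine ⟨t, fun j hj => ?_, ?_⟩
      · have h2 : (⟨l, hln⟩ : Fin n) ≠ j := (hj.trans htl).ne'
        simp [h2, hj.ne']
      · simp [Ne.symm ht]
        omega
    · rfl

/-- The largest index of a variable dividing a monomial. -/
def maxVar (u : Fin n →₀ ℕ) : ℕ := u.support.sup fun t => (t : ℕ)

/-- The monomials of degree `d` with the lexicographic order. -/
def lexMonomials (n d : ℕ) : Finset (Lex (Fin n →₀ ℕ)) :=
  ((Finset.univ : Finset (Fin n)).finsuppAntidiag d).map toLex.toEmbedding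

theorem mem_lexMonomials {u : Lex (Fin n →₀ ℕ)} :
    u ∈ lexMonomials n d ↔ ∑ t, ofLex u t = d := by
  rw [lexMonomials, Finset.mem_map]
  constructor
  · rintro ⟨v, hv, rfl⟩
    exact (Finset.mem_finsuppAntidiag.1 hv).1
  · intro h
    exact ⟨ofLex u, Finset.mem_finsuppAntidiag.2 ⟨h, Finset.subset_univ _⟩, rfl⟩

theorem exists_leading_forms (V : ℕ → Submodule k ((Fin d → ℕ) → Finset ℕ → k))
    [∀ i, FiniteDimensional k (V i)] (hV : ∀ i, ∀ z ∈ V i, IsStrandForm n d i z)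
    (hstable : ∀ i, ∀ z ∈ V (i + 1), ∀ l < n, enContract l z ∈ V i) :
    ∃ W : Lex (Fin n →₀ ℕ) → ℕ → Submodule k (Finset ℕ → k),
      (∀ i, Module.finrank k (V i) = ∑ u ∈ lexMonomials n d, Module.finrank k (W u i)) ∧
      (∀ u i, ∀ w ∈ W u i, ∀ I, w I ≠ 0 → I ⊆ Finset.range (maxVar (ofLex u)) ∧ I.card = i) ∧
      ∀ u i, ∀ w ∈ W u (i + 1), ∀ l < n, contract l w ∈ W u i := by
  let c : ℕ → Lex (Fin n →₀ ℕ) → ((Fin d → ℕ) → Finset ℕ → k) →ₗ[k] (Finset ℕ → k) :=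
    fun i u => cycleCoeff n d i (ofLex u)
  refine ⟨fun u i => (leadingPart (c i) (lexMonomials n d) (V i) u).map (c i u),
    fun i => finrank_eq_sum_leadingPart _ _ _ fun z hz h => ?_, ?_, ?_⟩
  · refine (hV i z hz).eq_zero_of_cycleCoeff fun u => ?_
    by_cases hu : ∑ t, u t = d
    · exact h (toLex u) (mem_lexMonomials.2 hu)
    · exact cycleCoeff_eq_zero_of_degree_ne hu z
  · rintro u i _ ⟨z, hz, rfl⟩ I hI
    refine ⟨fun l hl => ?_, ?_⟩
    · by_contra hl'
      rw [Finset.mem_range, not_lt] at hl'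
      refine hI (cycleCoeff_eq_zero_of_mem (fun v hv => ?_) hl fun t ht =>
        (Finset.le_sup (f := fun t : Fin n => (t : ℕ)) ht).trans hl')
      by_cases hvd : ∑ t, v t = d
      · exact hz.2 (toLex v) (mem_lexMonomials.2 hvd) hv
      · exact cycleCoeff_eq_zero_of_degree_ne hvd z
    · by_contra hc
      exact hI (if_neg fun h => hc h.2)
  · rintro u i _ ⟨z, hz, rfl⟩ l hl
    refine ⟨enContract l z, ⟨hstable i z hz.1 l hl, fun v hv hvu => ?_⟩,
      cycleCoeff_enContract i _ hl z⟩
    simp only [c]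
    rw [cycleCoeff_enContract i _ hl]
    have := hz.2 v hv hvu
    simp only [c] at this
    rw [this, map_zero]

end LeadingForms

/-! ### Coefficient maps of the differentials; the Koszul side. -/

section CoefficientMaps

universe u

variable {k : Type u} [Field k] {n : ℕ}

theorem C_posSign {m : ℕ} (T : Finset (Fin m)) (t : Fin m) :
    (MvPolynomial.C (posSign k T t) : MvPolynomial (Fin n) k) =
      posSign (MvPolynomial (Fin n) k) T t := by
  simp [posSign]

/-- The Koszul differential of a sequence of linear forms. -/
theorem isLinearMapOfForms_koszulD {m : ℕ} (f : Fin m → MvPolynomial (Fin n) k)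
    (a : Fin n → Fin m → k) (hf : ∀ t, f t = ∑ l, MvPolynomial.X l * MvPolynomial.C (a l t))
    (i : ℕ) : IsLinearMapOfForms (koszulD f i) fun l => koszulD (a l) i := by
  intro w
  induction w using Finsupp.induction_linear with
  | zero => simp
  | add v w hv hw => simp only [map_add, hv, hw, smul_add, Finset.sum_add_distrib]
  | single T c =>
    simp only [constExt_single, koszulD, Finsupp.linearCombination_single, Finset.smul_sum,
      map_sum, Finsupp.smul_single, smul_eq_mul]
    rw [Finset.sum_comm]
    refine Finset.sum_congr rfl fun t _ => ?_
    rw [hf, ← Finsupp.single_finsetSum, Finset.mul_sum, Finset.mul_sum]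
    congr 1
    refine Finset.sum_congr rfl fun l _ => ?_
    rw [map_mul, map_mul, map_neg, C_posSign]
    ring

/-- The Eagon–Northcott differential of a matrix of linear forms. -/
theorem isLinearMapOfForms_eagonNorthcottD {g f : ℕ}
    (A : Matrix (Fin g) (Fin f) (MvPolynomial (Fin n) k)) (a : Fin n → Matrix (Fin g) (Fin f) k)
    (hA : ∀ j s, A j s = ∑ l, MvPolynomial.X l * MvPolynomial.C (a l j s))
    (i : ℕ) : IsLinearMapOfForms (eagonNorthcottD A i) fun l => eagonNorthcottD (a l) i := by
  intro w
  induction w using Finsupp.induction_linear with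
  | zero => simp
  | add v w hv hw => simp only [map_add, hv, hw, smul_add, Finset.sum_add_distrib]
  | single b c =>
    simp only [constExt_single, eagonNorthcottD, Finsupp.linearCombination_single, Finset.smul_sum,
      map_sum]
    refine Eq.trans ?_ Finset.sum_comm
    refine Finset.sum_congr rfl fun t _ => ?_
    refine Eq.trans ?_ Finset.sum_comm
    refine Finset.sum_congr rfl fun j _ => ?_
    by_cases h : 0 < b.1.1 j
    · simp only [dif_pos h, constExt_single, Finsupp.smul_single, smul_eq_mul]
      rw [hA, ← Finsupp.single_finsetSum, Finset.mul_sum, Finset.mul_sum]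
      congr 1
      refine Finset.sum_congr rfl fun l _ => ?_
      rw [map_mul, map_mul, C_posSign]
      ring
    · simp [h]

theorem posSign_eq {R : Type*} [CommRing R] {m : ℕ} (T : Finset (Fin m)) (t : Fin m) :
    posSign R T t = (-1) ^ ((T.map Fin.valEmbedding).filter (· < (t : ℕ))).card := by
  rw [posSign, Finset.filter_map, Finset.card_map]
  rfl

theorem mapDomain_koszulD {m : ℕ} (f : Fin m → k) (i : ℕ) (w : Subsets m (i + 1) →₀ k)
    (I : Finset (Fin m)) :
    Finsupp.mapDomain Subtype.val (koszulD f i w) I = ∑ t, if t ∈ I then 0 else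
      -posSign k I t * f t * Finsupp.mapDomain Subtype.val w (insert t I) := by
  induction w using Finsupp.induction_linear with
  | zero => simp
  | add v w hv hw =>
    rw [map_add, Finsupp.mapDomain_add, Finsupp.add_apply, hv, hw, ← Finset.sum_add_distrib]
    refine Finset.sum_congr rfl fun t _ => ?_
    split_ifs
    · simp
    · rw [Finsupp.mapDomain_add, Finsupp.add_apply, mul_add]
  | single T c =>
    rw [koszulD_single, Finsupp.finsetSum_apply, ← Finset.sum_subset (Finset.subset_univ T.1)]
    · refine Finset.sum_congr rfl fun t ht => ?_
      rw [Finsupp.mapDomain_single, Finsupp.single_apply, Finsupp.single_apply]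
      by_cases h : t ∈ I
      · have h1 : T.1.erase t ≠ I := by rintro rfl; exact Finset.notMem_erase t _ h
        rw [if_neg h1, if_pos h]
      · rw [if_neg h]
        have h1 : T.1.erase t = I ↔ T.1 = insert t I := Finset.erase_eq_iff_eq_insert ht h
        by_cases h2 : T.1 = insert t I
        · have h3 : posSign k T.1 t = posSign k I t := by
            rw [h2, posSign, posSign, Finset.filter_insert, if_neg (lt_irrefl t)]
          rw [if_pos (h1.2 h2), if_pos h2, h3]
          ring
        · rw [if_neg (fun h => h2 (h1.1 h)), if_neg h2, mul_zero]
    · intro t _ ht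
      split_ifs
      · rfl
      · rw [Finsupp.mapDomain_single, Finsupp.single_apply, if_neg, mul_zero]
        intro h
        exact ht (by rw [h]; exact Finset.mem_insert_self _ _)

/-- The coefficients of an alternating form on the subsets of `{0, …, m-1}` of a given size. -/
noncomputable def restrictForm (m i : ℕ) : (Finset ℕ → k) →ₗ[k] (Subsets m i →₀ k) :=
  (Finsupp.linearEquivFunOnFinite k k (Subsets m i)).symm.toLinearMap ∘ₗ
    LinearMap.funLeft k k fun I : Subsets m i => I.1.map Fin.valEmbedding

theorem restrictForm_apply (m i : ℕ) (w : Finset ℕ → k) (I : Subsets m i) :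
    restrictForm m i w I = w (I.1.map Fin.valEmbedding) := rfl

/-- The coefficient of `x_l` in the Koszul differential is contraction by `l`, up to a global sign
that does not affect stability of subspaces. -/
theorem koszulD_restrictForm {m : ℕ} (l i : ℕ) (w : Finset ℕ → k) :
    koszulD (fun t : Fin m => if (t : ℕ) = l then (1 : k) else 0) i (restrictForm m (i + 1) w) =
      if l < m then -restrictForm m i (contract l w) else 0 := by
  ext I
  have hinj : Function.Injective (Subtype.val : Subsets m i → Finset (Fin m)) :=
    Subtype.val_injective
  rw [← Finsupp.mapDomain_apply hinj, mapDomain_koszulD]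
  split_ifs with hl
  · rw [Finset.sum_eq_single_of_mem ⟨l, hl⟩ (Finset.mem_univ _), Finsupp.neg_apply,
      restrictForm_apply, contract_apply]
    · have h1 : l ∈ I.1.map Fin.valEmbedding ↔ (⟨l, hl⟩ : Fin m) ∈ I.1 := by
        simp only [Finset.mem_map, Fin.valEmbedding_apply]
        constructor
        · rintro ⟨a, ha, rfl⟩; exact ha
        · intro h; exact ⟨_, h, rfl⟩
      simp only [h1]
      split_ifs with h2
      · simp
      · have h3 : (insert (⟨l, hl⟩ : Fin m) I.1).card = i + 1 := by
          rw [Finset.card_insert_of_notMem h2, I.2]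
        have h4 := Finsupp.mapDomain_apply (Subtype.val_injective) (restrictForm m (i + 1) w)
          (⟨_, h3⟩ : Subsets m (i + 1))
        rw [h4, restrictForm_apply, posSign_eq]
        simp [Finset.map_insert]
    · intro t _ ht
      have : (t : ℕ) ≠ l := fun h => ht (Fin.ext h)
      simp [this]
  · refine Finset.sum_eq_zero fun t _ => ?_
    have : (t : ℕ) ≠ l := by omega
    simp [this]

theorem finrank_map_of_injOn {V V' : Type*} [AddCommGroup V] [Module k V] [AddCommGroup V']
    [Module k V'] (f : V →ₗ[k] V') (W : Submodule k V) (h : ∀ w ∈ W, f w = 0 → w = 0) :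
    Module.finrank k (W.map f) = Module.finrank k W := by
  have h1 : Function.Injective (f.domRestrict W) := by
    rw [injective_iff_map_eq_zero]
    intro w hw
    exact Subtype.ext (h w w.2 hw)
  have h2 : (f.domRestrict W).range = W.map f := by
    ext y
    simp
  rw [← h2]
  exact LinearMap.finrank_range_of_inj h1

theorem finrank_mem_RS_koszulVars {m : ℕ} (hm : m ≤ n) (W : ℕ → Submodule k (Finset ℕ → k))
    (hW : ∀ i, ∀ w ∈ W i, ∀ I, w I ≠ 0 → I ⊆ Finset.range m ∧ I.card = i)
    (hstable : ∀ i, ∀ w ∈ W (i + 1), ∀ l < n, contract l w ∈ W i) :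
    (fun i => Module.finrank k (W i)) ∈ RS (koszulVars k n m hm) := by
  have h1 : ∀ i, Module.finrank k ((W i).map (restrictForm m i)) = Module.finrank k (W i) := by
    intro i
    refine finrank_map_of_injOn _ _ fun w hw h => ?_
    ext I
    by_contra hI
    obtain ⟨h2, h3⟩ := hW i w hw I hI
    have h4 : ∀ t ∈ I, t < m := fun t ht => Finset.mem_range.1 (h2 ht)
    have h5 : (I.attachFin h4).map Fin.valEmbedding = I := by
      ext t
      simp only [Finset.mem_map, Finset.mem_attachFin, Fin.valEmbedding_apply]
      constructor
      · rintro ⟨a, ha, rfl⟩; exact ha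
      · intro ht; exact ⟨⟨t, h4 t ht⟩, ht, rfl⟩
    have h6 := DFunLike.congr_fun h (⟨I.attachFin h4, by rw [Finset.card_attachFin, h3]⟩ :
      Subsets m i)
    rw [restrictForm_apply, h5] at h6
    exact hI h6
  simp only [← h1]
  refine finrank_mem_RS
    (fun i => koszulD (fun t : Fin m => (MvPolynomial.X (Fin.castLE hm t) : MvPolynomial (Fin n) k)) i)
    (fun i l => koszulD (fun t : Fin m => if (t : ℕ) = l then (1 : k) else 0) i)
    (fun i => isLinearMapOfForms_koszulD _ (fun l t => if (t : ℕ) = l then (1 : k) else 0)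
      (fun t => ?_) i)
    (fun i => by rw [← ModuleCat.ofHom_comp, koszulD_comp]; rfl) _ ?_
  · rw [Finset.sum_eq_single_of_mem (Fin.castLE hm t) (Finset.mem_univ _)]
    · simp
    · intro l _ hl
      have : (t : ℕ) ≠ l := fun h => hl (Fin.ext h.symm)
      simp [this]
  · rintro i _ ⟨w, hw, rfl⟩ l
    rw [koszulD_restrictForm]
    split_ifs
    · exact Submodule.neg_mem _ ⟨_, hstable i w hw l l.2, rfl⟩
    · exact Submodule.zero_mem _

end CoefficientMaps

/-! ### The Eagon–Northcott side, counting monomials, and the conclusion. -/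

section StrandEmbedding

universe u

variable {k : Type u} [Field k] {n d : ℕ}

/-- The exponents and the columns of a basis element of the Eagon–Northcott complex. -/
def enBasisIndex {g f i : ℕ} (b : ENBasis g f i) : (Fin g → ℕ) × Finset ℕ :=
  (b.1.1, b.2.1.map Fin.valEmbedding)

theorem enBasisIndex_injective {g f i : ℕ} :
    Function.Injective (enBasisIndex : ENBasis g f i → (Fin g → ℕ) × Finset ℕ) := by
  rintro ⟨p, T⟩ ⟨q, U⟩ h
  simp only [enBasisIndex, Prod.mk.injEq, Finset.map_inj] at h
  exact Prod.ext (Subtype.ext h.1) (Subtype.ext h.2)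

/-- The embedding of the Eagon–Northcott modules into one space. -/
noncomputable def strandEmb (g f i : ℕ) :
    (ENBasis g f i →₀ k) →ₗ[k] ((Fin g → ℕ) → Finset ℕ → k) where
  toFun z p T := Finsupp.mapDomain enBasisIndex z (p, T)
  map_add' v w := by
    ext p T
    rw [Finsupp.mapDomain_add]
    rfl
  map_smul' c w := by
    ext p T
    rw [Finsupp.mapDomain_smul]
    rfl

theorem strandEmb_apply {g f i : ℕ} (z : ENBasis g f i →₀ k) (p : Fin g → ℕ) (T : Finset ℕ) :
    strandEmb g f i z p T = Finsupp.mapDomain enBasisIndex z (p, T) := rfl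

theorem strandEmb_injective {g f i : ℕ} :
    Function.Injective (strandEmb g f i : (ENBasis g f i →₀ k) → _) := by
  intro v w h
  apply Finsupp.mapDomain_injective enBasisIndex_injective
  ext ⟨p, T⟩
  exact congrFun (congrFun h p) T

theorem strandEmb_single {g f i : ℕ} (b : ENBasis g f i) (c : k) (p : Fin g → ℕ)
    (T : Finset ℕ) : strandEmb g f i (Finsupp.single b c) p T =
      if b.1.1 = p ∧ b.2.1.map Fin.valEmbedding = T then c else 0 := by
  rw [strandEmb_apply, Finsupp.mapDomain_single, Finsupp.single_apply]
  simp only [enBasisIndex, Prod.mk.injEq]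

theorem isStrandForm_strandEmb {i : ℕ} (z : ENBasis d (n + d - 1) i →₀ k) :
    IsStrandForm n d i (strandEmb d (n + d - 1) i z) := by
  intro p T h
  rw [strandEmb_apply] at h
  obtain ⟨b, hb⟩ : ∃ b : ENBasis d (n + d - 1) i, enBasisIndex b = (p, T) := by
    classical
    obtain ⟨b, -, hb⟩ := Finset.mem_image.1
      (Finsupp.mapDomain_support (Finsupp.mem_support_iff.2 h))
    exact ⟨b, hb⟩
  simp only [enBasisIndex, Prod.mk.injEq] at hb
  obtain ⟨rfl, rfl⟩ := hb
  refine ⟨b.1.2, fun t ht => ?_, by rw [Finset.card_map, b.2.2]⟩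
  obtain ⟨a, -, rfl⟩ := Finset.mem_map.1 ht
  exact Finset.mem_range.2 a.2

/-- The coefficient of `x_l` in the matrix `M^{n,d}`. -/
def stripCoeff (k : Type*) [Field k] (n d l : ℕ) : Matrix (Fin d) (Fin (n + d - 1)) k :=
  Matrix.of fun j s => if (s : ℕ) = l + j then 1 else 0

theorem enMatrix_eq_sum (j : Fin d) (s : Fin (n + d - 1)) :
    enMatrix k n d j s =
      ∑ l : Fin n, MvPolynomial.X l * MvPolynomial.C (stripCoeff k n d l j s) := by
  simp only [enMatrix, stripCoeff, Matrix.of_apply]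
  split_ifs with h
  · rw [Finset.sum_eq_single_of_mem ⟨s - j, h.2⟩ (Finset.mem_univ _)]
    · rw [if_pos (by simp only; omega)]
      simp
    · intro l _ hl
      rw [if_neg, map_zero, mul_zero]
      intro hs
      exact hl (Fin.ext (by simp only; omega))
  · symm
    refine Finset.sum_eq_zero fun l _ => ?_
    rw [if_neg, map_zero, mul_zero]
    intro hs
    omega

/-- In row `j` the variable `x_l` stands only in column `l + j`, so the component at `(p, T)`
receives contributions only from `(p + ε_j, T ∪ {l + j})`. -/
theorem strandEmb_eagonNorthcottD {i l : ℕ} (z : ENBasis d (n + d - 1) (i + 1) →₀ k) :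
    strandEmb d (n + d - 1) i (eagonNorthcottD (stripCoeff k n d l) i z) =
      enContract l (strandEmb d (n + d - 1) (i + 1) z) := by
  induction z using Finsupp.induction_linear with
  | zero => simp
  | add v w hv hw => simp only [map_add, hv, hw]
  | single b c =>
    ext p T
    have h1 : strandEmb d (n + d - 1) i
        (eagonNorthcottD (stripCoeff k n d l) i (Finsupp.single b c)) p T =
        Finsupp.mapDomain (Prod.map id (Finset.map Fin.valEmbedding))
          (Finsupp.mapDomain (Prod.map Subtype.val Subtype.val)
            (eagonNorthcottD (stripCoeff k n d l) i (Finsupp.single b c))) (p, T) := by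
      rw [← Finsupp.mapDomain_comp]
      rfl
    rw [h1, eagonNorthcottD_single, Finset.sum_comm, Finsupp.mapDomain_finsetSum,
      Finsupp.finsetSum_apply, enContract_apply, Finset.sum_apply]
    refine Finset.sum_congr rfl fun j _ => ?_
    have hp : 0 < b.1.1 j ∧ b.1.1 - Pi.single j 1 = p ↔ b.1.1 = p + Pi.single j 1 := by
      constructor
      · rintro ⟨h2, rfl⟩
        refine (tsub_add_cancel_of_le fun a => ?_).symm
        by_cases ha : a = j
        · subst ha; simpa using Nat.succ_le_of_lt h2
        · simp [ha]
      · intro h2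
        rw [h2]
        simp
    have h2 : ∀ t : Fin (n + d - 1), Finsupp.mapDomain (Prod.map id (Finset.map Fin.valEmbedding))
        (if 0 < b.1.1 j then Finsupp.single (b.1.1 - Pi.single j 1, b.2.1.erase t)
          (c * (posSign k b.2.1 t * stripCoeff k n d l j t)) else 0) (p, T) =
        if b.1.1 = p + Pi.single j 1 ∧ (b.2.1.erase t).map Fin.valEmbedding = T then
          c * (posSign k b.2.1 t * stripCoeff k n d l j t) else 0 := by
      intro t
      by_cases h3 : 0 < b.1.1 j
      · rw [if_pos h3, Finsupp.mapDomain_single, Finsupp.single_apply]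
        simp only [Prod.map_apply, id, Prod.mk.injEq, ← hp, h3, true_and]
      · rw [if_neg h3, Finsupp.mapDomain_zero, Finsupp.zero_apply, if_neg]
        exact fun h4 => h3 (hp.2 h4.1).1
    rw [Finsupp.mapDomain_finsetSum, Finsupp.finsetSum_apply]
    simp only [h2, contract_apply, strandEmb_single]
    by_cases ht : ∃ t ∈ b.2.1, (t : ℕ) = l + j
    · obtain ⟨t, ht, hlj⟩ := ht
      rw [← hlj, Finset.sum_eq_single_of_mem t ht]
      · have h4 : (b.2.1.erase t).map Fin.valEmbedding =
            (b.2.1.map Fin.valEmbedding).erase (t : ℕ) := Finset.map_erase _ _ _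
        have h5 : (t : ℕ) ∈ b.2.1.map Fin.valEmbedding :=
          Finset.mem_map.2 ⟨t, ht, rfl⟩
        by_cases h6 : (t : ℕ) ∈ T
        · rw [if_pos h6, if_neg]
          rintro ⟨-, h7⟩
          rw [← h7, h4] at h6
          exact Finset.notMem_erase _ _ h6
        · have h8 : (b.2.1.erase t).map Fin.valEmbedding = T ↔
              b.2.1.map Fin.valEmbedding = insert (t : ℕ) T := by
            rw [h4, Finset.erase_eq_iff_eq_insert h5 h6]
          rw [if_neg h6]
          simp only [h8]
          by_cases h7 : b.1.1 = p + Pi.single j 1 ∧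
            b.2.1.map Fin.valEmbedding = insert (t : ℕ) T
          · rw [if_pos h7, if_pos h7, posSign_eq, h7.2, Finset.filter_insert,
              if_neg (lt_irrefl _), stripCoeff, Matrix.of_apply, if_pos hlj]
            ring
          · rw [if_neg h7, if_neg h7, mul_zero]
      · intro s _ hs
        have : (s : ℕ) ≠ l + j := fun h => hs (Fin.ext (h.trans hlj.symm))
        simp [stripCoeff, this]
    · push Not at ht
      rw [Finset.sum_eq_zero]
      · split_ifs with h3 h4
        · rfl
        · exfalso
          have h5 : l + (j : ℕ) ∈ b.2.1.map Fin.valEmbedding := by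
            rw [h4.2]; exact Finset.mem_insert_self _ _
          obtain ⟨t, ht', htt⟩ := Finset.mem_map.1 h5
          exact ht t ht' htt
        · simp
      · intro t ht'
        simp [stripCoeff, ht t ht']

instance finite_exponents (g i : ℕ) : Finite (Exponents g i) := by
  refine Finite.of_injective (β := Fin g → Fin (i + 1)) (fun p j => ⟨p.1 j, ?_⟩) ?_
  · have := Finset.single_le_sum (f := p.1) (fun _ _ => Nat.zero_le _) (Finset.mem_univ j)
    rw [p.2] at this
    omega
  · intro p q h
    ext j
    exact congrArg Fin.val (congrFun h j)

theorem exists_stable_of_mem_RS_linearStrand {r : ℕ → ℕ} (hr : r ∈ RS (linearStrand k n d)) :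
    ∃ V : ∀ i, Submodule k (ENBasis d (n + d - 1) i →₀ k), (∀ i, Module.finrank k (V i) = r i) ∧
      ∀ i, ∀ v ∈ V (i + 1), ∀ l : Fin n, eagonNorthcottD (stripCoeff k n d l) i v ∈ V i :=
  exists_stable_of_mem_RS (fun i => eagonNorthcottD (enMatrix k n d) i)
    (fun i l => eagonNorthcottD (stripCoeff k n d l) i)
    (fun i => isLinearMapOfForms_eagonNorthcottD (enMatrix k n d) (fun l => stripCoeff k n d l)
      enMatrix_eq_sum i)
    (fun i => by rw [← ModuleCat.ofHom_comp, eagonNorthcottD_comp]; rfl) hr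

theorem finrank_map_strandEmb {i : ℕ} (V : Submodule k (ENBasis d (n + d - 1) i →₀ k)) :
    Module.finrank k (V.map (strandEmb d (n + d - 1) i)) = Module.finrank k V :=
  (LinearEquiv.finrank_eq (V.equivMapOfInjective _ strandEmb_injective)).symm

theorem finiteDimensional_map_strandEmb {i : ℕ}
    (V : Submodule k (ENBasis d (n + d - 1) i →₀ k)) :
    FiniteDimensional k (V.map (strandEmb d (n + d - 1) i)) :=
  Submodule.finiteDimensional_of_le (S₂ := (strandEmb d (n + d - 1) i).range)
    LinearMap.map_le_range

theorem exists_forms_of_mem_RS_linearStrand {r : ℕ → ℕ} (hr : r ∈ RS (linearStrand k n d)) :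
    ∃ W : Lex (Fin n →₀ ℕ) → ℕ → Submodule k (Finset ℕ → k),
      (∀ i, r i = ∑ u ∈ lexMonomials n d, Module.finrank k (W u i)) ∧
      (∀ u i, ∀ w ∈ W u i, ∀ I, w I ≠ 0 → I ⊆ Finset.range (maxVar (ofLex u)) ∧ I.card = i) ∧
      ∀ u i, ∀ w ∈ W u (i + 1), ∀ l < n, contract l w ∈ W u i := by
  obtain ⟨V, hV, hstable⟩ := exists_stable_of_mem_RS_linearStrand hr
  have hfin := fun i => finiteDimensional_map_strandEmb (V i)
  obtain ⟨W, hW1, hW2, hW3⟩ := exists_leading_forms (n := n) (d := d)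
    (fun i => (V i).map (strandEmb d (n + d - 1) i))
    (by
      rintro i _ ⟨z, -, rfl⟩
      exact isStrandForm_strandEmb z)
    (by
      rintro i _ ⟨z, hz, rfl⟩ l hl
      exact ⟨_, hstable i z hz ⟨l, hl⟩, strandEmb_eagonNorthcottD z⟩)
  refine ⟨W, fun i => ?_, hW2, hW3⟩
  rw [← hV i, ← hW1 i, finrank_map_strandEmb]

theorem maxVar_lt (hn : 0 < n) (u : Fin n →₀ ℕ) : maxVar u < n :=
  (Finset.sup_lt_iff hn).2 fun t _ => t.2

/-- Variables are numbered from 0 in `maxVar`, so dividing by the last variable leaves a monomial of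
degree `d - 1` in `m + 1` variables. An upper bound is enough, as fold sums can be padded by zero.
-/
theorem card_filter_maxVar_le (hn : 0 < n) (hd : 0 < d) (m : ℕ) :
    ((lexMonomials n d).filter fun u => maxVar (ofLex u) = m).card ≤
      Nat.choose (m + d - 1) (d - 1) := by
  by_cases hm : m < n
  swap
  · rw [Finset.filter_false_of_mem]
    · simp
    · intro u _
      have := maxVar_lt hn (ofLex u)
      omega
  have hs : (Finset.Iic (⟨m, hm⟩ : Fin n)).card = m + 1 := Fin.card_Iic _
  have h1 := Finset.card_finsuppAntidiag_nat_eq_choose (s := Finset.Iic (⟨m, hm⟩ : Fin n)) (d - 1)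
  rw [hs, show m + 1 + (d - 1) - 1 = m + d - 1 by omega] at h1
  rw [← h1]
  have h2 : ∀ u ∈ (lexMonomials n d).filter fun u => maxVar (ofLex u) = m,
      Finsupp.single (⟨m, hm⟩ : Fin n) 1 ≤ ofLex u := by
    intro u hu
    obtain ⟨hu1, hu2⟩ := Finset.mem_filter.1 hu
    rw [mem_lexMonomials] at hu1
    have h3 : (ofLex u).support.Nonempty := by
      rw [Finsupp.support_nonempty_iff]
      intro h
      rw [h] at hu1
      simp at hu1
      omega
    obtain ⟨t, ht, ht'⟩ := Finset.exists_mem_eq_sup _ h3 fun t : Fin n => (t : ℕ)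
    have h4 : t = ⟨m, hm⟩ := Fin.ext (ht'.symm.trans hu2)
    rw [Finsupp.single_le_iff, ← h4]
    exact Nat.one_le_iff_ne_zero.2 (Finsupp.mem_support_iff.1 ht)
  refine Finset.card_le_card_of_injOn (fun u => ofLex u - Finsupp.single (⟨m, hm⟩ : Fin n) 1) ?_ ?_
  · intro u hu
    have hle := h2 u hu
    obtain ⟨hu1, hu2⟩ := Finset.mem_filter.1 hu
    rw [mem_lexMonomials] at hu1
    have hsupp : (ofLex u - Finsupp.single (⟨m, hm⟩ : Fin n) 1).support ⊆ Finset.Iic (⟨m, hm⟩ : Fin n) := by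
      intro t ht
      have h3 : t ∈ (ofLex u).support := by
        rw [Finsupp.mem_support_iff] at ht ⊢
        intro h
        simp [h] at ht
      have h4 : (t : ℕ) ≤ maxVar (ofLex u) := Finset.le_sup (f := fun t : Fin n => (t : ℕ)) h3
      rw [Finset.mem_Iic, Fin.le_def]
      simp only
      omega
    refine Finset.mem_finsuppAntidiag.2 ⟨?_, hsupp⟩
    have h5 : ∑ t, (ofLex u - Finsupp.single (⟨m, hm⟩ : Fin n) 1 : Fin n →₀ ℕ) t + 1 = d := by
      rw [← hu1]
      conv_rhs => rw [← tsub_add_cancel_of_le hle]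
      simp [Finset.sum_add_distrib, Finsupp.single_apply]
    rw [Finset.sum_subset (Finset.subset_univ _)]
    · exact Nat.eq_sub_of_add_eq h5
    · intro t _ ht
      by_contra h
      exact ht (hsupp (Finsupp.mem_support_iff.2 h))
  · intro u hu v hv h
    have h3 : ofLex u = ofLex v := by
      rw [← tsub_add_cancel_of_le (h2 u hu), ← tsub_add_cancel_of_le (h2 v hv)]
      exact congrArg (· + _) h
    exact h3

theorem sum_mem_foldSum {ι : Type*} (s : Finset ι) (ρ : ι → ℕ → ℕ) {A : Set (ℕ → ℕ)} (hA : 0 ∈ A)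
    (hρ : ∀ u ∈ s, ρ u ∈ A) (c : ℕ) (hc : s.card ≤ c) : ∑ u ∈ s, ρ u ∈ foldSum c A := by
  classical
  induction s using Finset.induction_on generalizing c with
  | empty => exact ⟨fun _ => 0, fun _ => hA, by simp⟩
  | insert a s ha ih =>
    rw [Finset.card_insert_of_notMem ha] at hc
    obtain ⟨c, rfl⟩ : ∃ c', c = c' + 1 := ⟨c - 1, by omega⟩
    obtain ⟨f, hf, hsum⟩ := ih (fun u hu => hρ u (Finset.mem_insert_of_mem hu)) c (by omega)
    refine ⟨Fin.cons (ρ a) f, fun i => ?_, ?_⟩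
    · refine Fin.cases ?_ (fun i => ?_) i
      · exact hρ a (Finset.mem_insert_self _ _)
      · simpa using hf i
    · rw [Finset.sum_insert ha, Fin.sum_cons, hsum]

theorem zero_mem_RS_koszulVars {m : ℕ} (hm : m ≤ n) : (0 : ℕ → ℕ) ∈ RS (koszulVars k n m hm) := by
  have := finrank_mem_RS_koszulVars (k := k) hm (fun _ => ⊥)
    (fun i w hw I hI => absurd (by rw [(Submodule.mem_bot k).1 hw]; rfl) hI)
    (fun i w hw l _ => by rw [(Submodule.mem_bot k).1 hw, map_zero]; exact Submodule.zero_mem _)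
  convert this
  simp

theorem sub_sub_one_le (n j : ℕ) : n - j - 1 ≤ n := (Nat.sub_le _ _).trans (Nat.sub_le _ _)

theorem RS_linearStrand_subset (hn : 0 < n) (hd : 0 < d) :
    RS (linearStrand k n d) ⊆
      ∑ j : Fin n, foldSum (Nat.choose (n - j.1 + d - 2) (d - 1))
        (RS (koszulVars k n (n - j.1 - 1) (sub_sub_one_le n j))) := by
  intro r hr
  obtain ⟨W, hW1, hW2, hW3⟩ := exists_forms_of_mem_RS_linearStrand hr
  let ρ : Lex (Fin n →₀ ℕ) → ℕ → ℕ := fun u i => Module.finrank k (W u i)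
  have hρ : ∀ u m (hm : m ≤ n), maxVar (ofLex u) = m → ρ u ∈ RS (koszulVars k n m hm) := by
    rintro u m hm rfl
    exact finrank_mem_RS_koszulVars hm (W u) (hW2 u) (hW3 u)
  have hr' : r = ∑ j : Fin n, ∑ u ∈ (lexMonomials n d).filter
      (fun u => maxVar (ofLex u) = n - j.1 - 1), ρ u := by
    have h1 : ∀ j : Fin n, (lexMonomials n d).filter (fun u => maxVar (ofLex u) = n - j.1 - 1) =
        (lexMonomials n d).filter
          (fun u => (⟨maxVar (ofLex u), maxVar_lt hn _⟩ : Fin n).rev = j) := by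
      intro j
      refine Finset.filter_congr fun u _ => ?_
      have := maxVar_lt hn (ofLex u)
      rw [Fin.ext_iff, Fin.val_rev]
      simp only
      omega
    simp only [h1]
    rw [Finset.sum_fiberwise_of_maps_to (fun _ _ => Finset.mem_univ _)]
    ext i
    rw [hW1 i, Finset.sum_apply]
  rw [hr']
  refine Set.finsetSum_mem_finsetSum _ _ _ fun j _ => ?_
  refine sum_mem_foldSum _ _ (zero_mem_RS_koszulVars _) (fun u hu => ?_) _ ?_
  · exact hρ u _ _ (Finset.mem_filter.1 hu).2
  · refine (card_filter_maxVar_le hn hd _).trans (le_of_eq ?_)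
    congr 1
    omega

end StrandEmbedding

theorem mainTheorem4 {k : Type*} [Field k] (n d : ℕ) (hn : 2 ≤ n) (hd : 2 ≤ d) :
    RS (linearStrand k n d) ⊆
        ∑ j : Fin n, foldSum (Nat.choose (n - j.1 + d - 2) (d - 1))
          (RS (koszulVars k n (n - j.1 - 1) (by omega))) ∧
      ∀ r ∈ RS (linearStrand k n d),
        ∃ (N : ℕ) (c m : Fin N → ℕ) (hm : ∀ i, m i < n) (s : Fin N → ℕ → ℕ),
          0 < N ∧ (∀ i, 0 < c i) ∧ (∀ i, s i ∈ RS (koszulVars k n (m i) (hm i).le)) ∧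
            r = ∑ i, c i • s i := by
  have hsub := RS_linearStrand_subset (k := k) (n := n) (d := d) (by omega) (by omega)
  refine ⟨hsub, fun r hr => ?_⟩
  obtain ⟨g, hg, rfl⟩ := (Set.mem_finsetSum _ _ _).1 (hsub hr)
  have hg' : ∀ j, g j ∈ foldSum (Nat.choose (n - j.1 + d - 2) (d - 1))
      (RS (koszulVars k n (n - j.1 - 1) (by omega))) := fun j => hg (Finset.mem_univ j)
  choose f hf hsum using hg'
  let e := Fintype.equivFin (Σ j : Fin n, Fin (Nat.choose (n - j.1 + d - 2) (d - 1)))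
  -- All summands of all fold sums are listed separately with coefficient 1. The list is nonempty
  -- because the binomial coefficient for `j = 0` is positive.
  refine ⟨_, fun _ => 1, fun i => n - (e.symm i).1.1 - 1, fun i => ?_,
    fun i => f (e.symm i).1 (e.symm i).2, ?_, fun _ => Nat.one_pos, fun i => hf _ _, ?_⟩
  · have := (e.symm i).1.2
    simp only
    omega
  · rw [Fintype.card_pos_iff]
    refine ⟨⟨⟨0, by omega⟩, ⟨0, Nat.choose_pos ?_⟩⟩⟩
    simp only
    omega
  · simp only [one_smul]
    rw [e.symm.sum_comp fun x => f x.1 x.2, Fintype.sum_sigma]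
    exact Finset.sum_congr rfl fun j _ => hsum j
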